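/- Let $0<a<b<1$. For a real polynomial $f$ put $$\mathcal V(f)=\frac{1}{2\pi^{2}}\int_{a}^{b}\frac{f(x)}{\sqrt{(b-x)(x-a)}}\left(P\!\int_{a}^{b}\frac{\sqrt{(b-y)(y-a)}}{x-y}\,f'(y)\,dy\right)dx ,$$ where $P\!\int$ is the Cauchy principal value; this is the large-$N$ variance of the linear statistic $\sum_j f(x_j)$ of the eigenvalues of a Hermitian random matrix whose limiting density is supported on $[a,b]$. Let $U_n$ be the Chebyshev polynomials of the second kind, with $U_{-1}=0$, $U_{-2}=-1$, and let $\widehat U_n(x)=U_n\!\left(\frac{2x}{b-a}-\frac{b+a}{b-a}\right)$. For $n\ge 0$ define $$\widehat P_n=A'\,\widehat U_{n-2}+B'\,\widehat U_{n-1}+C'\,\widehat U_n,$$ $$A'=(\sqrt b-\sqrt a)(\sqrt{1-b}-\sqrt{1-a}),\quad B'=2\left[\sqrt{b(1-b)}-\sqrt{a(1-a)}\right],\quad C'=(\sqrt b+\sqrt a)(\sqrt{1-b}+\sqrt{1-a}).$$ (1) Each $\widehat P_n$ has degree exactly $n$, and for all $m\ge 0$, $n\ge 1$, $$\int_a^b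 \widehat P_m(x)\widehat P_n(x)\frac{\sqrt{(b-x)(x-a)}}{x(1-x)}\,dx=2\pi(b-a)^2\delta_{mn}.$$ (2) For $K\ge 0$, real $c_0,\dots,c_K$ and $f=\sum_{n=0}^K c_n\widehat P_n$, the principal values exist for all $x\in(a,b)$, the outer integrand is integrable, and $$\mathcal V(f)=\sum_{m=1}^K\sum_{n=1}^K c_mc_nR(m,n),$$ where $R(m,n)=R(n,m)$ and, with $k=\min(m,n)\ge 1$: - if $m,n$ have different parity, $R(m,n)=2k(b-a)\left[\sqrt{(1-a)(1-b)}-\sqrt{ab}-ka-kb+k\right]$; - if $m\ne n$ are both even, $R(m,n)=2k(a+b)\sqrt{(1-a)(1-b)}-2k\sqrt{ab}\,(a+b-2)-2k^2(a^2+b^2-a-b)$; - if $m\neq n$ are both odd, $R(m,n)=2\sqrt{(1-a)(1-b)}\,(ka+kb+2\sqrt{ab})-2k\sqrt{ab}\,(a+b-2)-2k^2(a^2+b^2-a-b)$; - if $m=n$, $R(n,n)$ is the expression of the same parity with $k=n$, plus $n(a-b)^2$. (3) Let $K=5$ and write $p=\sqrt a+\sqrt b$, $q=\sqrt{1-a}+\sqrt{1-b}$,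 $D=\sqrt{a(1-a)}-\sqrt{b(1-b)}$, $S=\sqrt{a(1-a)}+\sqrt{b(1-b)}$, $$\alpha=\frac1{pq},\qquad \beta=\frac{2D}{p^2q^2},\qquad \gamma=\frac{4D^2}{p^3q^3}-\frac{2S}{p^2q^2},$$ $$\xi=\frac{8D^3}{p^4q^4}-\frac{4(a-b)(1-a-b)}{p^3q^3}+\frac{2D(\sqrt a-\sqrt b)^2}{p^2q^4},$$ $$\zeta=\frac{16D^4}{p^5q^5}+\frac{12(\sqrt a-\sqrt b)^2D^2}{p^3q^5}-\frac{4D^2}{p^3q^3}-\frac{2S(\sqrt a-\sqrt b)^2}{p^2q^4}.$$ The matrix $$M=\begin{pmatrix}\alpha&\beta&\gamma&\xi&\zeta\\0&\alpha&\beta&\gamma&\xi\\0&0&\alpha&\beta&\gamma\\0&0&0&\alpha&\beta\\0&0&0&0&\alpha\end{pmatrix}$$ is invertible, and if $(c_1,\dots,c_5)^T=M(d_1,\dots,d_5)^T$ then for every real $c_0$ and $f=\sum_{n=0}^5c_n\widehat P_n$, $$\mathcal V(f)=\sum_{n=1}^5 n\,d_n^2 .$$ -/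

import Mathlib

open Filter Topology Set MeasureTheory Polynomial
open scoped Matrix

noncomputable section

namespace LinStat

/-- `HasPV a b x g L`: the principal value integral of `g` over `(a, b)`, with singularity at the
point `x`, exists and equals `L`. -/
def HasPV (a b x : ℝ) (g : ℝ → ℝ) (L : ℝ) : Prop :=
  (∀ ε : ℝ, 0 < ε → IntegrableOn g {y | y ∈ Ioo a b ∧ ε < |x - y|}) ∧
    Tendsto (fun ε : ℝ => ∫ y in {y | y ∈ Ioo a b ∧ ε < |x - y|}, g y) (𝓝[>] 0) (𝓝 L)

/-- `HasVariance a b f V`: the large `N` variance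
`(1 / 2π²) ∫_a^b f(x) / √((b-x)(x-a)) (P ∫_a^b √((b-y)(y-a)) / (x-y) f'(y) dy) dx`
of the linear statistic of `f` is well defined (`H x` is the inner principal value integral)
and equals `V`. -/
def HasVariance (a b : ℝ) (f : ℝ → ℝ) (V : ℝ) : Prop :=
  ∃ H : ℝ → ℝ,
    (∀ x ∈ Ioo a b,
      HasPV a b x (fun y => √((b - y) * (y - a)) / (x - y) * deriv f y) (H x)) ∧
    IntervalIntegrable (fun x => f x / √((b - x) * (x - a)) * H x) volume a b ∧
    V = 1 / (2 * Real.pi ^ 2) * ∫ x in a..b, f x / √((b - x) * (x - a)) * H x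

/-- The translated Chebyshev polynomial of the second kind `U_n(2x/(b-a) - (b+a)/(b-a))`.
The index is an integer, `U_{-1} = 0` and `U_{-2} = -1` coming from the recurrence. -/
def Uhat (a b : ℝ) (n : ℤ) : ℝ[X] :=
  (Polynomial.Chebyshev.U ℝ n).comp
    (Polynomial.C (2 / (b - a)) * X - Polynomial.C ((b + a) / (b - a)))

def coeffA (a b : ℝ) : ℝ := (√b - √a) * (√(1 - b) - √(1 - a))

def coeffB (a b : ℝ) : ℝ := 2 * (√(b * (1 - b)) - √(a * (1 - a)))

def coeffC (a b : ℝ) : ℝ := (√b + √a) * (√(1 - b) + √(1 - a))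

/-- The polynomials `A' Û_{n-2} + B' Û_{n-1} + C' Û_n`. -/
def Phat (a b : ℝ) (n : ℕ) : ℝ[X] :=
  coeffA a b • Uhat a b ((n : ℤ) - 2) + coeffB a b • Uhat a b ((n : ℤ) - 1)
    + coeffC a b • Uhat a b (n : ℤ)

/-- The weight `√((b-x)(x-a)) / (x(1-x))`. -/
def weight (a b x : ℝ) : ℝ := √((b - x) * (x - a)) / (x * (1 - x))

/-- Entry of the quadratic form for indices of different parity, the smaller one being `k`. -/
def Rmixed (a b : ℝ) (k : ℕ) : ℝ :=
  2 * k * (b - a) * (√((1 - a) * (1 - b)) - √(a * b) - k * a - k * b + k)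

/-- Entry for two distinct even indices, the smaller one being `k`. -/
def Reven (a b : ℝ) (k : ℕ) : ℝ :=
  2 * k * (a + b) * √((1 - a) * (1 - b)) - 2 * k * √(a * b) * (a + b - 2)
    - 2 * k ^ 2 * (a ^ 2 + b ^ 2 - a - b)

/-- Entry for two distinct odd indices, the smaller one being `k`. -/
def Rodd (a b : ℝ) (k : ℕ) : ℝ :=
  2 * √((1 - a) * (1 - b)) * (k * a + k * b + 2 * √(a * b)) - 2 * k * √(a * b) * (a + b - 2)
    - 2 * k ^ 2 * (a ^ 2 + b ^ 2 - a - b)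

/-- The matrix `R(m, n)` of the quadratic form, used for `m, n ≥ 1`. -/
def R (a b : ℝ) (m n : ℕ) : ℝ :=
  if Even m then
    if Odd n then
      if n < m then Rmixed a b n else Rmixed a b m
    else
      if n < m then Reven a b n
      else if n = m then Reven a b n + n * (a - b) ^ 2
      else Reven a b m
  else
    if Even n then
      if n < m then Rmixed a b n else Rmixed a b m
    else
      if n < m then Rodd a b n
      else if n = m then Rodd a b n + n * (a - b) ^ 2
      else Rodd a b m

def α (a b : ℝ) : ℝ := 1 / ((√a + √b) * (√(1 - a) + √(1 - b)))

def β (a b : ℝ) : ℝ :=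
  2 * (√(a * (1 - a)) - √(b * (1 - b))) / ((√a + √b) ^ 2 * (√(1 - a) + √(1 - b)) ^ 2)

def γ (a b : ℝ) : ℝ :=
  4 * (√(a * (1 - a)) - √(b * (1 - b))) ^ 2 / ((√a + √b) ^ 3 * (√(1 - a) + √(1 - b)) ^ 3)
    - 2 * (√(a * (1 - a)) + √(b * (1 - b))) / ((√a + √b) ^ 2 * (√(1 - a) + √(1 - b)) ^ 2)

def ξ (a b : ℝ) : ℝ :=
  8 * (√(a * (1 - a)) - √(b * (1 - b))) ^ 3 / ((√a + √b) ^ 4 * (√(1 - a) + √(1 - b)) ^ 4)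
    - 4 * (a - b) * (1 - a - b) / ((√a + √b) ^ 3 * (√(1 - a) + √(1 - b)) ^ 3)
    + 2 * (√(a * (1 - a)) - √(b * (1 - b))) * (√a - √b) ^ 2
      / ((√a + √b) ^ 2 * (√(1 - a) + √(1 - b)) ^ 4)

def ζ (a b : ℝ) : ℝ :=
  16 * (√(a * (1 - a)) - √(b * (1 - b))) ^ 4 / ((√a + √b) ^ 5 * (√(1 - a) + √(1 - b)) ^ 5)
    + 12 * (√a - √b) ^ 2 * (√(a * (1 - a)) - √(b * (1 - b))) ^ 2
      / ((√a + √b) ^ 3 * (√(1 - a) + √(1 - b)) ^ 5)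
    - 4 * (√(a * (1 - a)) - √(b * (1 - b))) ^ 2
      / ((√a + √b) ^ 3 * (√(1 - a) + √(1 - b)) ^ 3)
    - 2 * (√(a * (1 - a)) + √(b * (1 - b))) * (√a - √b) ^ 2
      / ((√a + √b) ^ 2 * (√(1 - a) + √(1 - b)) ^ 4)

/-- The transformation `c = M d` for `K = 5`. -/
def transform5 (a b : ℝ) : Matrix (Fin 5) (Fin 5) ℝ :=
  !![α a b, β a b, γ a b, ξ a b, ζ a b;
     0,     α a b, β a b, γ a b, ξ a b;
     0,     0,     α a b, β a b, γ a b;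
     0,     0,     0,     α a b, β a b;
     0,     0,     0,     0,     α a b]

end LinStat

end

/-! Variance. Let `That` be the Chebyshev polynomials of the first kind transported to [a, b]. Since
T_n' is a multiple of U_{n-1}, and the finite Hilbert transform sends √((b-y)(y-a)) U_{n-1} to a
multiple of T_n (`hasPV_sqrt_mul_Uhat`), the inner principal value for T_n is πn T_n. The T_n are
orthogonal for the arcsine weight, so the variance of ∑ e_k T_k is (1/4) ∑ k e_k²
(`hasVariance_sum_That`). From 2T_k = U_k - U_{k-2}, the coefficients of `Phat` in this basis depend
only on parity below the top degree (`chebCoeff`). Hence R = (1/4) XᵀDX, with X the coefficient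
matrix and D = diag(k), and its entries are explicit first moments. For K = 5, X is upper triangular
Toeplitz and M = 2X⁻¹, which makes the form diagonal.

Orthogonality, of Bernstein–Szegő type. Put h(z) = C' + B'z + A'z². With x = (b-a)/2 cos θ + (a+b)/2
and z = exp(iθ), P̂_n(x) sin θ is the imaginary part of z^(n+1) times the conjugate of h(z), and
|h(z)|² = 16x(1-x). The weighted product of P̂_m and P̂_n is therefore 8 cos((m-n)θ) minus 8 times
the real part of z^(m+n) (C'z² + B'z + A') / h(z). As h has no zero in the closed disc
(`coeff_quadratic_ne_zero`), the mean value property removes the last term when m + n ≥ 1. -/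

namespace LinStat

/-! ### Integrals against the arcsine weight -/

theorem sqrt_affine {a b : ℝ} (hab : a < b) (t : ℝ) :
    √((b - ((b - a) / 2 * t + (a + b) / 2)) * ((b - a) / 2 * t + (a + b) / 2 - a))
      = (b - a) / 2 * √(1 - t ^ 2) := by
  rw [show (b - ((b - a) / 2 * t + (a + b) / 2)) * ((b - a) / 2 * t + (a + b) / 2 - a)
    = ((b - a) / 2) ^ 2 * (1 - t ^ 2) by ring, Real.sqrt_mul (by positivity),
    Real.sqrt_sq (by linarith)]

/-- The affine substitution `x = (b - a) / 2 * t + (a + b) / 2` in an integral against the arcsine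
weight of `[a, b]`. -/
theorem integral_div_sqrt {a b : ℝ} (hab : a < b) (f : ℝ → ℝ) :
    ∫ x in a..b, f x / √((b - x) * (x - a))
      = ∫ t, f ((b - a) / 2 * t + (a + b) / 2) ∂Chebyshev.measureT := by
  have h : (b - a) / 2 ≠ 0 := by
    have : 0 < b - a := by linarith
    positivity
  have key := intervalIntegral.integral_comp_mul_add (a := -1) (b := 1)
    (fun x => f x / √((b - x) * (x - a))) h ((a + b) / 2)
  rw [show (b - a) / 2 * (-1) + (a + b) / 2 = a by ring,
    show (b - a) / 2 * 1 + (a + b) / 2 = b by ring, smul_eq_mul] at key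
  rw [Chebyshev.integral_measureT, ← mul_right_inj' (inv_ne_zero h), ← key,
    ← intervalIntegral.integral_const_mul]
  refine intervalIntegral.integral_congr fun t _ => ?_
  simp only [sqrt_affine hab, Real.sqrt_inv]
  rw [div_eq_mul_inv, mul_inv]
  ring

/-- The trigonometric substitution in an integral against the arcsine weight. -/
theorem integral_div_sqrt_eq_integral_cos {a b : ℝ} (hab : a < b) (f : ℝ → ℝ) :
    ∫ x in a..b, f x / √((b - x) * (x - a))
      = ∫ θ in 0..Real.pi, f ((b - a) / 2 * Real.cos θ + (a + b) / 2) := by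
  rw [integral_div_sqrt hab, Chebyshev.integral_measureT_eq_integral_cos]

/-- The trigonometric substitution in an integral against the semicircle weight. -/
theorem integral_mul_sqrt_eq_integral_cos {a b : ℝ} (hab : a < b) (f : ℝ → ℝ) :
    ∫ x in a..b, f x * √((b - x) * (x - a))
      = ((b - a) / 2) ^ 2 * ∫ θ in 0..Real.pi,
          f ((b - a) / 2 * Real.cos θ + (a + b) / 2) * Real.sin θ ^ 2 := by
  have : ∫ x in a..b, f x * √((b - x) * (x - a))
      = ∫ x in a..b, (f x * ((b - x) * (x - a))) / √((b - x) * (x - a)) := by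
    refine intervalIntegral.integral_congr fun x hx => ?_
    rw [mul_div_assoc, Real.div_sqrt]
  rw [this, integral_div_sqrt_eq_integral_cos hab, ← intervalIntegral.integral_const_mul]
  refine intervalIntegral.integral_congr fun θ _ => ?_
  simp only [Real.sin_sq]
  ring

theorem sub_mul_sub_pos {a b x : ℝ} (hx : x ∈ Ioo a b) : 0 < (b - x) * (x - a) :=
  mul_pos (by linarith [hx.2]) (by linarith [hx.1])

/-- This antiderivative serves twice: for integrability of the arcsine weight, and as the part of an
antiderivative that produces the π in the Hilbert transform. -/
theorem hasDerivAt_arcsin_affine {a b x : ℝ} (hx : x ∈ Ioo a b) :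
    HasDerivAt (fun y => Real.arcsin ((y - (a + b) / 2) / ((b - a) / 2)))
      (1 / √((b - x) * (x - a))) x := by
  obtain ⟨h1, h2⟩ := hx
  have h : 0 < (b - a) / 2 := by linarith
  have hin : HasDerivAt (fun y => (y - (a + b) / 2) / ((b - a) / 2)) (1 / ((b - a) / 2)) x :=
    ((hasDerivAt_id x).sub_const _).div_const _
  have hne1 : (x - (a + b) / 2) / ((b - a) / 2) ≠ -1 := by
    rw [Ne, div_eq_iff h.ne']; intro h; linarith
  have hne2 : (x - (a + b) / 2) / ((b - a) / 2) ≠ 1 := by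
    rw [Ne, div_eq_iff h.ne']; intro h; linarith
  have := (Real.hasDerivAt_arcsin hne1 hne2).comp x hin
  refine this.congr_deriv ?_
  have hs := sqrt_affine (a := a) (b := b) (by linarith) ((x - (a + b) / 2) / ((b - a) / 2))
  rw [mul_div_cancel₀ _ h.ne', sub_add_cancel] at hs
  rw [hs, one_div_mul_one_div_rev]

theorem intervalIntegrable_div_sqrt {a b : ℝ} (hab : a < b) {f : ℝ → ℝ}
    (hf : ContinuousOn f (Icc a b)) :
    IntervalIntegrable (fun x => f x / √((b - x) * (x - a))) volume a b := by
  have h : IntervalIntegrable (fun x => 1 / √((b - x) * (x - a))) volume a b := by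
    rw [intervalIntegrable_iff, uIoc_of_le hab.le]
    refine intervalIntegral.integrableOn_deriv_of_nonneg
      (g := fun y => Real.arcsin ((y - (a + b) / 2) / ((b - a) / 2)))
      (Continuous.continuousOn (Real.continuous_arcsin.comp (by fun_prop))) ?_ ?_
    · intro x hx; exact hasDerivAt_arcsin_affine hx
    · intro x _; positivity
  have := h.continuousOn_mul (g := f) (by rwa [uIcc_of_le hab.le])
  simpa only [mul_one_div] using this

/-! ### Principal values -/

/-- The truncated domains omit x, so identities obtained by cancelling x - y may be used under the
principal value. -/
theorem HasPV.congr {a b x : ℝ} {g g' : ℝ → ℝ} {L : ℝ} (h : HasPV a b x g L)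
    (hg : ∀ y, y ≠ x → g y = g' y) : HasPV a b x g' L := by
  have hm : ∀ ε : ℝ, MeasurableSet {y | y ∈ Ioo a b ∧ ε < |x - y|} := fun ε =>
    measurableSet_Ioo.inter (measurableSet_lt measurable_const (by fun_prop : Measurable fun y => |x - y|))
  have hne : ∀ ε : ℝ, 0 < ε → EqOn g g' {y | y ∈ Ioo a b ∧ ε < |x - y|} := by
    rintro ε hε y ⟨-, hy⟩
    refine hg y ?_
    rintro rfl
    simp at hy
    linarith
  refine ⟨fun ε hε => (h.1 ε hε).congr_fun (hne ε hε) (hm ε), h.2.congr' ?_⟩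
  filter_upwards [self_mem_nhdsWithin] with ε hε
  exact setIntegral_congr_fun (hm ε) (hne ε hε)

theorem HasPV.add {a b x : ℝ} {g g' : ℝ → ℝ} {L L' : ℝ} (h : HasPV a b x g L)
    (h' : HasPV a b x g' L') : HasPV a b x (fun y => g y + g' y) (L + L') := by
  refine ⟨fun ε hε => (h.1 ε hε).add (h'.1 ε hε), (h.2.add h'.2).congr' ?_⟩
  filter_upwards [self_mem_nhdsWithin] with ε hε
  exact (integral_add (h.1 ε hε) (h'.1 ε hε)).symm

theorem HasPV.const_mul {a b x : ℝ} {g : ℝ → ℝ} {L : ℝ} (c : ℝ) (h : HasPV a b x g L) :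
    HasPV a b x (fun y => c * g y) (c * L) := by
  refine ⟨fun ε hε => (h.1 ε hε).const_mul c, (h.2.const_mul c).congr fun ε => ?_⟩
  exact (integral_const_mul _ _).symm

theorem HasPV.zero (a b x : ℝ) : HasPV a b x (fun _ => 0) 0 :=
  ⟨fun _ _ => integrableOn_zero, by simp⟩

theorem HasPV.sum {ι : Type*} {a b x : ℝ} (s : Finset ι) {g : ι → ℝ → ℝ} {L : ι → ℝ}
    (h : ∀ i ∈ s, HasPV a b x (g i) (L i)) :
    HasPV a b x (fun y => ∑ i ∈ s, g i y) (∑ i ∈ s, L i) := by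
  classical
  induction s using Finset.induction_on with
  | empty => simpa using HasPV.zero a b x
  | insert i s hi ih =>
    simp only [Finset.sum_insert hi]
    exact (h i (by simp)).add (ih fun j hj => h j (by simp [hj]))

/-- For an integrable function, the principal value is the integral. -/
theorem hasPV_of_integrableOn {a b x : ℝ} {g : ℝ → ℝ} (hg : IntegrableOn g (Ioo a b)) :
    HasPV a b x g (∫ y in Ioo a b, g y) := by
  have hm : ∀ ε : ℝ, MeasurableSet {y | ε < |x - y|} := fun ε =>
    measurableSet_lt measurable_const (by fun_prop : Measurable fun y => |x - y|)
  refine ⟨fun ε _ => hg.mono_set fun y hy => hy.1, ?_⟩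
  have h1 : ∀ ε : ℝ, ∫ y in {y | y ∈ Ioo a b ∧ ε < |x - y|}, g y
      = ∫ y in Ioo a b, {y | ε < |x - y|}.indicator g y := fun ε => by
    rw [setIntegral_indicator (hm ε)]; rfl
  simp only [h1]
  refine tendsto_integral_filter_of_dominated_convergence (fun y => ‖g y‖)
    (.of_forall fun ε => hg.1.indicator (hm ε))
    (.of_forall fun ε => .of_forall fun y => norm_indicator_le_norm_self g y) hg.norm ?_
  have : ∀ᵐ y ∂(volume.restrict (Ioo a b)), y ≠ x :=
    ae_restrict_of_ae (by simp [ae_iff, measure_singleton])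
  filter_upwards [this] with y hy
  refine tendsto_const_nhds.congr' ?_
  have hpos : 0 < |x - y| := abs_pos.2 (sub_ne_zero.2 hy.symm)
  filter_upwards [mem_nhdsWithin_of_mem_nhds (Iio_mem_nhds hpos)] with ε hε
  exact (indicator_of_mem (by exact hε) g).symm

/-! ### The finite Hilbert transform of the semicircle density -/

theorem integrableOn_div_sub_of_continuous (a b x : ℝ) {g : ℝ → ℝ} (hg : Continuous g)
    {ε : ℝ} (hε : 0 < ε) :
    IntegrableOn (fun y => g y / (x - y)) {y | y ∈ Ioo a b ∧ ε < |x - y|} := by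
  have hK : IsCompact (Icc a b ∩ {y | ε ≤ |x - y|}) :=
    isCompact_Icc.inter_right (isClosed_le continuous_const (by fun_prop))
  refine IntegrableOn.mono_set (t := Icc a b ∩ {y | ε ≤ |x - y|}) ?_
    fun y hy => ⟨Ioo_subset_Icc_self hy.1, hy.2.le⟩
  refine ContinuousOn.integrableOn_compact hK (hg.continuousOn.div (by fun_prop) ?_)
  rintro y ⟨-, hy⟩ h
  simp only [mem_ofPred_eq, h, abs_zero] at hy
  linarith

theorem abs_sub_gt_inter_Ioo {a b x ε : ℝ} (hε : 0 < ε) (ha : ε < x - a) (hb : ε < b - x) :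
    {y | y ∈ Ioo a b ∧ ε < |x - y|} = Ioo a (x - ε) ∪ Ioo (x + ε) b := by
  ext y
  simp only [mem_ofPred_eq, mem_Ioo, mem_union, lt_abs]
  constructor
  · rintro ⟨⟨h1, h2⟩, h3 | h3⟩
    · left; constructor <;> linarith
    · right; constructor <;> linarith
  · rintro (⟨h1, h2⟩ | ⟨h1, h2⟩)
    · exact ⟨⟨h1, by linarith⟩, Or.inl (by linarith)⟩
    · exact ⟨⟨by linarith, h2⟩, Or.inr (by linarith)⟩

/-- If `F y - c * log |x - y|` is, off `x`, an antiderivative of `g` with `F` continuous, then the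
principal value of `g` is given by the boundary values. -/
theorem hasPV_of_hasDerivAt {a b x : ℝ} (hx : x ∈ Ioo a b) {g F : ℝ → ℝ} (c : ℝ)
    (hF : ContinuousOn F (Icc a b))
    (hd : ∀ y ∈ Ioo a b, y ≠ x → HasDerivAt (fun y => F y - c * Real.log |x - y|) (g y) y)
    (hg : ∀ ε : ℝ, 0 < ε → IntegrableOn g {y | y ∈ Ioo a b ∧ ε < |x - y|}) :
    HasPV a b x g ((F b - c * Real.log |x - b|) - (F a - c * Real.log |x - a|)) := by
  obtain ⟨hax, hxb⟩ := hx
  refine ⟨hg, ?_⟩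
  have hc : ContinuousAt F x := (hF x ⟨hax.le, hxb.le⟩).continuousAt (Icc_mem_nhds hax hxb)
  -- The logarithms at x - ε and x + ε are both log ε and cancel; only F(x - ε) - F(x + ε) remains,
  -- and it tends to 0.
  have hlim : Tendsto (fun ε : ℝ => ((F b - c * Real.log |x - b|) - (F a - c * Real.log |x - a|))
      + (F (x - ε) - F (x + ε))) (𝓝[>] 0)
      (𝓝 (((F b - c * Real.log |x - b|) - (F a - c * Real.log |x - a|)) + (F x - F x))) := by
    refine tendsto_nhdsWithin_of_tendsto_nhds (tendsto_const_nhds.add (Tendsto.sub ?_ ?_))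
    · refine hc.tendsto.comp ?_
      have : Continuous fun ε : ℝ => x - ε := by fun_prop
      simpa using this.tendsto 0
    · refine hc.tendsto.comp ?_
      have : Continuous fun ε : ℝ => x + ε := by fun_prop
      simpa using this.tendsto 0
  rw [sub_self, add_zero] at hlim
  refine hlim.congr' ?_
  filter_upwards [self_mem_nhdsWithin,
    mem_nhdsWithin_of_mem_nhds (Iio_mem_nhds (sub_pos.2 hax)),
    mem_nhdsWithin_of_mem_nhds (Iio_mem_nhds (sub_pos.2 hxb))] with ε hε h1 h2
  simp only [mem_Ioi, mem_Iio] at hε h1 h2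
  have hset := abs_sub_gt_inter_Ioo hε h1 h2
  have hgi := hg ε hε
  rw [hset] at hgi ⊢
  have hG : ∀ y ∈ Icc a b, y ≠ x →
      ContinuousWithinAt (fun y => F y - c * Real.log |x - y|) (Icc a b) y := by
    intro y hy hne
    refine (hF y hy).sub (ContinuousWithinAt.mul continuousWithinAt_const ?_)
    refine ContinuousWithinAt.log ?_ (abs_ne_zero.2 (sub_ne_zero.2 hne.symm))
    exact Continuous.continuousWithinAt (by fun_prop)
  have ftc : ∀ u v, u ≤ v → Icc u v ⊆ Icc a b → x ∉ Icc u v → IntegrableOn g (Ioo u v) →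
      ∫ y in Ioo u v, g y
        = (F v - c * Real.log |x - v|) - (F u - c * Real.log |x - u|) := by
    intro u v huv hsub hxn hi
    have hne : ∀ y ∈ Icc u v, y ≠ x := fun y hy h => hxn (h ▸ hy)
    have hu := hsub (left_mem_Icc.2 huv)
    have hv := hsub (right_mem_Icc.2 huv)
    rw [← integral_Ioc_eq_integral_Ioo, ← intervalIntegral.integral_of_le huv]
    refine intervalIntegral.integral_eq_sub_of_hasDerivAt_of_le huv
      (f := fun y => F y - c * Real.log |x - y|)
      (fun y hy => (hG y (hsub hy) (hne y hy)).mono hsub) (fun y hy => ?_) ?_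
    · exact hd y ⟨hu.1.trans_lt hy.1, hy.2.trans_le hv.2⟩ (hne y (Ioo_subset_Icc_self hy))
    · rwa [intervalIntegrable_iff, uIoc_of_le huv, integrableOn_Ioc_iff_integrableOn_Ioo]
  rw [setIntegral_union ?_ measurableSet_Ioo (hgi.mono_set subset_union_left)
    (hgi.mono_set subset_union_right),
    ftc a (x - ε) (by linarith) (Icc_subset_Icc le_rfl (by linarith))
      (fun h => by linarith [h.2]) (hgi.mono_set subset_union_left),
    ftc (x + ε) b (by linarith) (Icc_subset_Icc (by linarith) le_rfl)
      (fun h => by linarith [h.1]) (hgi.mono_set subset_union_right)]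
  · have e1 : |x - (x - ε)| = ε := by rw [sub_sub_cancel, abs_of_pos hε]
    have e2 : |x - (x + ε)| = ε := by rw [sub_add_cancel_left, abs_neg, abs_of_pos hε]
    rw [e1, e2]
    ring
  · rw [disjoint_left]
    intro y h1 h2
    linarith [h1.2, h2.1]

/-- The finite Hilbert transform of the semicircle density. -/
theorem hasPV_sqrt {a b x : ℝ} (hx : x ∈ Ioo a b) :
    HasPV a b x (fun y => √((b - y) * (y - a)) / (x - y)) (Real.pi * (x - (a + b) / 2)) := by
  have hab : a < b := hx.1.trans hx.2
  have hh : 0 < (b - a) / 2 := by linarith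
  set W : ℝ := √((b - x) * (x - a)) with hW
  have hW2 : W ^ 2 = (b - x) * (x - a) := Real.sq_sqrt (sub_mul_sub_pos hx).le
  have hWpos : 0 < W := Real.sqrt_pos.2 (sub_mul_sub_pos hx)
  -- Write V = √((b-y)(y-a)) and μ = (a+b)/2. Then V² = W² + (x-y)((x-μ) + (y-μ)), so V/(x-y) =
  -- W²/(V(x-y)) + (x-μ)/V + (y-μ)/V. The last two terms integrate to (x-μ) arcsin and -V, the first
  -- to W(log N - log|x-y|). Positivity of N keeps the regular part continuous up to the endpoints.
  set N : ℝ → ℝ := fun y => ((b - a) / 2) ^ 2 - (x - (a + b) / 2) * (y - (a + b) / 2)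
    + W * √((b - y) * (y - a)) with hN
  have hNpos : ∀ y ∈ Icc a b, 0 < N y := by
    intro y hy
    have h1 : 0 ≤ W * √((b - y) * (y - a)) := by positivity
    have h2 : 0 < ((b - a) / 2) ^ 2 - (x - (a + b) / 2) * (y - (a + b) / 2) := by
      -- This sum is twice the quantity to be bounded.
      have hs : 0 < (x - a) * (b - y) + (b - x) * (y - a) := by
        rcases hy.1.eq_or_lt with rfl | h
        · simpa using mul_pos (sub_pos.2 hx.1) (sub_pos.2 hab)
        · have := mul_nonneg (sub_nonneg.2 hx.1.le) (sub_nonneg.2 hy.2)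
          have := mul_pos (sub_pos.2 hx.2) (sub_pos.2 h)
          linarith
      linarith
    simp only [hN]
    linarith
  set F : ℝ → ℝ := fun y => W * Real.log (N y)
    + (x - (a + b) / 2) * Real.arcsin ((y - (a + b) / 2) / ((b - a) / 2))
    - √((b - y) * (y - a)) with hFdef
  have hNc : Continuous N := by fun_prop
  have hF : ContinuousOn F (Icc a b) := by
    refine ContinuousOn.sub (ContinuousOn.add (continuousOn_const.mul
      (hNc.continuousOn.log fun y hy => (hNpos y hy).ne')) ?_) (Continuous.continuousOn (by fun_prop))
    exact (continuous_const.mul (Real.continuous_arcsin.comp (by fun_prop))).continuousOn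
  have key := hasPV_of_hasDerivAt hx (g := fun y => √((b - y) * (y - a)) / (x - y)) W hF ?_
    (fun ε hε => integrableOn_div_sub_of_continuous a b x (by fun_prop) hε)
  · convert key using 1
    have ea : (a - (a + b) / 2) / ((b - a) / 2) = -1 := by rw [div_eq_iff hh.ne']; ring
    have eb : (b - (a + b) / 2) / ((b - a) / 2) = 1 := by rw [div_eq_iff hh.ne']; ring
    -- At both endpoints log N - log|x-y| equals log((b-a)/2), so the logarithms cancel and only the
    -- jump π of the arcsine survives.
    have na : N a = (b - a) / 2 * |x - a| := by
      rw [abs_of_pos (sub_pos.2 hx.1)]; simp only [hN, sub_self, mul_zero, Real.sqrt_zero]; ring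
    have nb : N b = (b - a) / 2 * |x - b| := by
      rw [abs_of_neg (sub_neg.2 hx.2)]
      simp only [hN, sub_self, zero_mul, mul_zero, Real.sqrt_zero]; ring
    have xa : |x - a| ≠ 0 := abs_ne_zero.2 (sub_pos.2 hx.1).ne'
    have xb : |x - b| ≠ 0 := abs_ne_zero.2 (sub_neg.2 hx.2).ne
    simp only [hFdef]
    rw [ea, eb, na, nb, Real.log_mul hh.ne' xa, Real.log_mul hh.ne' xb, Real.arcsin_one,
      Real.arcsin_neg_one]
    simp only [sub_self, zero_mul, mul_zero, Real.sqrt_zero]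
    ring
  · intro y hy hne
    have hxy : x - y ≠ 0 := sub_ne_zero.2 hne.symm
    set V : ℝ := √((b - y) * (y - a)) with hV
    have hV2 : V ^ 2 = (b - y) * (y - a) := Real.sq_sqrt (sub_mul_sub_pos hy).le
    have hVpos : 0 < V := Real.sqrt_pos.2 (sub_mul_sub_pos hy)
    have dV : HasDerivAt (fun y => √((b - y) * (y - a)))
        ((-(1 : ℝ) * (y - a) + (b - y) * 1) / (2 * V)) y := by
      refine HasDerivAt.sqrt (HasDerivAt.mul ?_ ?_) (sub_mul_sub_pos hy).ne'
      · simpa using (hasDerivAt_id y).const_sub b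
      · simpa using (hasDerivAt_id y).sub_const a
    have dlin : HasDerivAt (fun y => ((b - a) / 2) ^ 2 - (x - (a + b) / 2) * (y - (a + b) / 2))
        (-((x - (a + b) / 2) * 1)) y :=
      (((hasDerivAt_id y).sub_const _).const_mul _).const_sub _
    have dN := dlin.add (dV.const_mul W)
    have dlogN := (dN.log (hNpos y (Ioo_subset_Icc_self hy)).ne').const_mul W
    have darc := (hasDerivAt_arcsin_affine hy).const_mul (x - (a + b) / 2)
    have dxy : HasDerivAt (fun y => Real.log |x - y|) (-1 / (x - y)) y := by
      simp only [Real.log_abs]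
      refine HasDerivAt.log ?_ hxy
      simpa using (hasDerivAt_id y).const_sub x
    refine (((dlogN.add darc).sub dV).sub (dxy.const_mul W)).congr_deriv ?_
    have hNy : 0 < ((b - a) / 2) ^ 2 - (x - (a + b) / 2) * (y - (a + b) / 2) + W * V :=
      hNpos y (Ioo_subset_Icc_self hy)
    simp only [Pi.add_apply]
    rw [← hV]
    have hne' := hNy.ne'
    set D : ℝ := ((b - a) / 2) ^ 2 - (x - (a + b) / 2) * (y - (a + b) / 2) + W * V with hD
    have hVne := hVpos.ne'
    field_simp
    rw [hD]
    linear_combination (2 * (W ^ 2 - (((b - a) / 2) ^ 2 - (x - (a + b) / 2) * (y - (a + b) / 2) + W * V))) * hV2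
      + (2 * ((((b - a) / 2) ^ 2 - (x - (a + b) / 2) * (y - (a + b) / 2) + W * V) - W * V)) * hW2

/-! ### Chebyshev polynomials diagonalise the variance. -/

/-- The translated Chebyshev polynomial of the first kind. -/
noncomputable def That (a b : ℝ) (n : ℤ) : ℝ[X] :=
  (Polynomial.Chebyshev.T ℝ n).comp
    (Polynomial.C (2 / (b - a)) * X - Polynomial.C ((b + a) / (b - a)))

theorem eval_Uhat (a b x : ℝ) (n : ℤ) : (Uhat a b n).eval x
    = (Polynomial.Chebyshev.U ℝ n).eval (2 / (b - a) * x - (b + a) / (b - a)) := by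
  simp [Uhat]

theorem eval_That (a b x : ℝ) (n : ℤ) : (That a b n).eval x
    = (Polynomial.Chebyshev.T ℝ n).eval (2 / (b - a) * x - (b + a) / (b - a)) := by
  simp [That]

theorem affine_inv {a b : ℝ} (hab : a < b) (t : ℝ) :
    2 / (b - a) * ((b - a) / 2 * t + (a + b) / 2) - (b + a) / (b - a) = t := by
  have : b - a ≠ 0 := (sub_pos.2 hab).ne'
  field_simp
  ring

theorem eval_Uhat_affine {a b : ℝ} (hab : a < b) (t : ℝ) (n : ℤ) :
    (Uhat a b n).eval ((b - a) / 2 * t + (a + b) / 2) = (Polynomial.Chebyshev.U ℝ n).eval t := by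
  rw [eval_Uhat, affine_inv hab]

theorem eval_That_affine {a b : ℝ} (hab : a < b) (t : ℝ) (n : ℤ) :
    (That a b n).eval ((b - a) / 2 * t + (a + b) / 2) = (Polynomial.Chebyshev.T ℝ n).eval t := by
  rw [eval_That, affine_inv hab]

theorem derivative_That (a b : ℝ) (n : ℤ) :
    derivative (That a b n) = Polynomial.C (2 / (b - a) * n) * Uhat a b (n - 1) := by
  rw [That, derivative_comp, Polynomial.Chebyshev.T_derivative_eq_U, Uhat]
  simp
  ring

theorem integral_cos_int_mul_mul_cos_int_mul (m n : ℕ) (hn : n ≠ 0) :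
    ∫ θ in 0..Real.pi, Real.cos (m * θ) * Real.cos (n * θ)
      = if m = n then Real.pi / 2 else 0 := by
  have h := Chebyshev.integral_measureT_eq_integral_cos
    (f := fun x => (Chebyshev.T ℝ m).eval x * (Chebyshev.T ℝ n).eval x)
  simp only [Chebyshev.T_real_cos, Int.cast_natCast] at h
  rw [← h]
  split_ifs with hmn
  · subst hmn; exact Chebyshev.integral_T_real_mul_self_measureT_of_ne_zero hn
  · exact Chebyshev.integral_eval_T_real_mul_eval_T_real_measureT_of_ne hmn

/-- The integral of `U_n` against the semicircle weight. -/
theorem integral_sqrt_mul_Uhat {a b : ℝ} (hab : a < b) (n : ℕ) :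
    ∫ y in Ioo a b, √((b - y) * (y - a)) * (Uhat a b n).eval y
      = if n = 0 then Real.pi / 2 * ((b - a) / 2) ^ 2 else 0 := by
  rw [← integral_Ioc_eq_integral_Ioo, ← intervalIntegral.integral_of_le hab.le]
  simp_rw [mul_comm (√_)]
  rw [integral_mul_sqrt_eq_integral_cos hab]
  -- U_n(cos θ) sin² θ = sin((n+1)θ) sin θ; the factor cos(0·θ) puts both terms into the form of the
  -- cosine orthogonality.
  have h : ∀ θ : ℝ, (Uhat a b n).eval ((b - a) / 2 * Real.cos θ + (a + b) / 2) * Real.sin θ ^ 2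
      = 1 / 2 * (Real.cos (n * θ) * Real.cos ((0 : ℕ) * θ))
        - 1 / 2 * (Real.cos ((n + 2 : ℕ) * θ) * Real.cos ((0 : ℕ) * θ)) := by
    intro θ
    rw [eval_Uhat_affine hab, pow_two, ← mul_assoc, Chebyshev.U_real_cos]
    push_cast
    have e1 : (n : ℝ) * θ = ((n : ℝ) + 1) * θ - θ := by ring
    have e2 : ((n : ℝ) + 2) * θ = ((n : ℝ) + 1) * θ + θ := by ring
    rw [e1, e2, Real.cos_add, Real.cos_sub, zero_mul, Real.cos_zero]
    ring
  have hI : ∀ k : ℕ, ∫ θ in 0..Real.pi, Real.cos (k * θ) * Real.cos ((0 : ℕ) * θ)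
      = if k = 0 then Real.pi else 0 := by
    intro k
    rcases eq_or_ne k 0 with rfl | hk
    · simp
    · simp_rw [mul_comm (Real.cos (k * _))]
      rw [integral_cos_int_mul_mul_cos_int_mul 0 k hk, if_neg hk.symm, if_neg hk]
  simp_rw [h]
  rw [intervalIntegral.integral_sub (Continuous.intervalIntegrable (by fun_prop) _ _)
    (Continuous.intervalIntegrable (by fun_prop) _ _), intervalIntegral.integral_const_mul,
    intervalIntegral.integral_const_mul, hI, hI]
  rw [if_neg (by omega : n + 2 ≠ 0)]
  split_ifs <;> ring

/-- The finite Hilbert transform maps `√((b - y)(y - a)) U_n` to `T_{n+1}`. -/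
theorem hasPV_sqrt_mul_Uhat {a b x : ℝ} (hx : x ∈ Ioo a b) (n : ℕ) :
    HasPV a b x (fun y => √((b - y) * (y - a)) / (x - y) * (Uhat a b n).eval y)
      (Real.pi * ((b - a) / 2) * (That a b (n + 1)).eval x) := by
  have hab : a < b := hx.1.trans hx.2
  have hba : b - a ≠ 0 := (sub_pos.2 hab).ne'
  have hint : ∀ k : ℕ, HasPV a b x (fun y => √((b - y) * (y - a)) * (Uhat a b k).eval y)
      (if k = 0 then Real.pi / 2 * ((b - a) / 2) ^ 2 else 0) := fun k => by
    rw [← integral_sqrt_mul_Uhat hab k]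
    refine hasPV_of_integrableOn (IntegrableOn.mono_set (t := Icc a b) ?_ Ioo_subset_Icc_self)
    exact (Continuous.continuousOn (by fun_prop)).integrableOn_compact isCompact_Icc
  -- Let t(y) be the affine argument. In U_{n+2} = 2tU_{n+1} - U_n write t(y) = t(x) - 2(x-y)/(b-a):
  -- the second part cancels the kernel and leaves the ordinary integral `hint`, nonzero only at
  -- index 0. What remains is the recurrence of the T_n.
  induction n using Nat.twoStepInduction with
  | zero =>
    have := hasPV_sqrt hx
    simp only [CharP.cast_eq_zero, zero_add, eval_Uhat, eval_That, Chebyshev.U_zero,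
      Chebyshev.T_one, eval_one, mul_one, eval_X]
    convert this using 1
    field_simp
    ring
  | one =>
    have key := ((hasPV_sqrt hx).const_mul (2 * (2 / (b - a) * x - (b + a) / (b - a)))).add
      ((hint 0).const_mul (-(4 / (b - a))))
    have hc := key.congr (g' := fun y => √((b - y) * (y - a)) / (x - y)
        * (Uhat a b (1 : ℕ)).eval y) ?_
    · convert hc using 1
      simp only [eval_That, Nat.cast_one, one_add_one_eq_two, Chebyshev.T_two, if_pos]
      simp only [eval_sub, eval_mul, eval_pow, eval_X, eval_one, eval_ofNat]
      field_simp
      ring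
    · intro y hy
      have hxy : x - y ≠ 0 := sub_ne_zero.2 hy.symm
      simp only [eval_Uhat, Nat.cast_one, Nat.cast_zero, Chebyshev.U_one, Chebyshev.U_zero,
        eval_mul, eval_X, eval_one, eval_ofNat]
      field_simp
      ring
  | more n ih0 ih1 =>
    have key := ((ih1.const_mul (2 * (2 / (b - a) * x - (b + a) / (b - a)))).add
      ((hint (n + 1)).const_mul (-(4 / (b - a))))).add (ih0.const_mul (-1))
    have hc := key.congr (g' := fun y => √((b - y) * (y - a)) / (x - y)
        * (Uhat a b (n + 2 : ℕ)).eval y) ?_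
    · convert hc using 1
      have e : ((n + 2 : ℕ) : ℤ) + 1 = (n + 1 : ℤ) + 2 := by push_cast; ring
      have e' : ((n + 1 : ℕ) : ℤ) + 1 = (n + 1 : ℤ) + 1 := by push_cast; ring
      simp only [eval_That]
      rw [e, e', Chebyshev.T_add_two, if_neg (Nat.succ_ne_zero n)]
      simp only [eval_sub, eval_mul, eval_X, eval_ofNat]
      ring
    · intro y hy
      have hxy : x - y ≠ 0 := sub_ne_zero.2 hy.symm
      simp only [eval_Uhat]
      push_cast
      rw [Chebyshev.U_add_two]
      simp only [eval_sub, eval_mul, eval_X, eval_ofNat]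
      field_simp
      ring

/-- The variance of a linear statistic in terms of its Chebyshev coefficients. -/
theorem hasVariance_sum_That {a b : ℝ} (hab : a < b) (e : ℕ → ℝ) (K : ℕ) :
    HasVariance a b (fun x => ∑ k ∈ Finset.range (K + 1), e k * (That a b k).eval x)
      (1 / 4 * ∑ k ∈ Finset.range (K + 1), k * e k ^ 2) := by
  have hba : b - a ≠ 0 := (sub_pos.2 hab).ne'
  have hpoly : ∀ x, ∑ k ∈ Finset.range (K + 1), e k * (That a b k).eval x
      = (∑ k ∈ Finset.range (K + 1), Polynomial.C (e k) * That a b k).eval x := by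
    intro x; simp [eval_finsetSum]
  refine ⟨fun x => ∑ k ∈ Finset.range (K + 1), Real.pi * (k * e k) * (That a b k).eval x,
    fun x hx => ?_, ?_, ?_⟩
  · simp_rw [hpoly, Polynomial.deriv, derivative_sum, eval_finsetSum, Finset.mul_sum]
    refine HasPV.sum _ fun k _ => ?_
    rcases k with - | k
    · simpa [That] using HasPV.zero a b x
    · have := (hasPV_sqrt_mul_Uhat hx k).const_mul (e (k + 1) * (2 / (b - a) * (k + 1)))
      convert this using 1
      · ext y
        simp [derivative_That]
        ring
      · push_cast
        field_simp
  · simp_rw [div_mul_eq_mul_div]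
    refine intervalIntegrable_div_sqrt hab (Continuous.continuousOn ?_)
    fun_prop
  · simp_rw [div_mul_eq_mul_div]
    rw [integral_div_sqrt_eq_integral_cos hab]
    simp_rw [eval_That_affine hab, Chebyshev.T_real_cos, Finset.sum_mul_sum]
    rw [intervalIntegral.integral_finsetSum
      fun i _ => Continuous.intervalIntegrable (by fun_prop) _ _, Finset.mul_sum, Finset.mul_sum,
      Finset.sum_div, Finset.sum_div]
    refine Finset.sum_congr rfl fun i hi => ?_
    rw [intervalIntegral.integral_finsetSum
      fun i _ => Continuous.intervalIntegrable (by fun_prop) _ _]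
    -- Orthogonality of cosines keeps the diagonal. For i ≥ 1 it contributes (π²/2) i e_i², and the
    -- prefactor 1/(2π²) gives 1/4.
    rw [Finset.sum_eq_single i]
    · have : ∀ θ : ℝ, e i * Real.cos ((i : ℤ) * θ) * (Real.pi * (i * e i) * Real.cos ((i : ℤ) * θ))
          = (Real.pi * i * e i ^ 2) * (Real.cos (i * θ) * Real.cos (i * θ)) := fun θ => by
        push_cast; ring
      simp_rw [this]
      rw [intervalIntegral.integral_const_mul]
      rcases eq_or_ne i 0 with rfl | h0
      · simp
      · rw [integral_cos_int_mul_mul_cos_int_mul i i h0, if_pos rfl]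
        field_simp
        norm_num
    · intro j _ hj
      have : ∀ θ : ℝ, e i * Real.cos ((i : ℤ) * θ) * (Real.pi * (j * e j) * Real.cos ((j : ℤ) * θ))
          = (e i * Real.pi * (j * e j)) * (Real.cos (i * θ) * Real.cos (j * θ)) := fun θ => by
        push_cast; ring
      simp_rw [this]
      rw [intervalIntegral.integral_const_mul]
      rcases eq_or_ne j 0 with rfl | h0
      · simp
      · rw [integral_cos_int_mul_mul_cos_int_mul i j h0, if_neg hj.symm, mul_zero]
    · intro h; exact absurd hi h

/-! ### Chebyshev coefficients of `Phat` -/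

/-- The coefficient of `That a b k`, `k ≥ 1`, in `Phat a b n`. -/
noncomputable def chebCoeff (a b : ℝ) (n k : ℕ) : ℝ :=
  if n < k then 0 else if k = n then 2 * coeffC a b
    else if Even (n + k) then 2 * (coeffA a b + coeffC a b) else 2 * coeffB a b

/-- Apply 2T_k = U_k - U_{k-2} to each of the three terms. Passing from n to n + 2 thus alters only
the coefficients in degrees n, n + 1, n + 2. -/
theorem eval_Phat_add_two (a b x : ℝ) (n : ℕ) :
    (Phat a b (n + 2)).eval x = (Phat a b n).eval x
      + 2 * (coeffA a b * (That a b n).eval x + coeffB a b * (That a b (n + 1 : ℕ)).eval x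
        + coeffC a b * (That a b (n + 2 : ℕ)).eval x) := by
  set t := 2 / (b - a) * x - (b + a) / (b - a) with ht
  have h : ∀ k : ℤ, 2 * (Chebyshev.T ℝ k).eval t
      = (Chebyshev.U ℝ k).eval t - (Chebyshev.U ℝ (k - 2)).eval t := fun k => by
    have := congrArg (eval t) (Chebyshev.two_mul_T_eq_U_sub_U ℝ (k - 2))
    simpa using this
  have h0 := h n
  have h1 := h (n + 1 : ℕ)
  have h2 := h (n + 2 : ℕ)
  simp only [Phat, eval_add, eval_smul, eval_Uhat, eval_That, smul_eq_mul, ← ht]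
  push_cast at h0 h1 h2 ⊢
  rw [show ((n : ℤ) + 1 - 2) = n - 1 by ring] at h1
  rw [show ((n : ℤ) + 2 - 2) = n by ring] at h2 ⊢
  rw [show ((n : ℤ) + 2 - 1) = n + 1 by ring]
  linear_combination (-coeffA a b) * h0 - coeffB a b * h1 - coeffC a b * h2

theorem chebCoeff_add_two (a b : ℝ) {n k : ℕ} (hk : k < n) :
    chebCoeff a b (n + 2) k - chebCoeff a b n k = 0 := by
  have h : Even (n + 2 + k) ↔ Even (n + k) := by
    rw [add_right_comm, Nat.even_add]; simp
  simp only [chebCoeff, h, if_neg (by omega : ¬ n + 2 < k), if_neg (by omega : ¬ n < k),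
    if_neg (by omega : k ≠ n + 2), if_neg (by omega : k ≠ n), sub_self]

theorem chebCoeff_self (a b : ℝ) (n : ℕ) : chebCoeff a b n n = 2 * coeffC a b := by
  simp [chebCoeff]

theorem chebCoeff_of_lt (a b : ℝ) {n k : ℕ} (h : n < k) : chebCoeff a b n k = 0 := by
  simp [chebCoeff, h]

theorem chebCoeff_of_even (a b : ℝ) {n k : ℕ} (h : k < n) (he : Even (n + k)) :
    chebCoeff a b n k = 2 * (coeffA a b + coeffC a b) := by
  simp [chebCoeff, he, h.not_gt, h.ne]

theorem chebCoeff_of_not_even (a b : ℝ) {n k : ℕ} (h : k < n) (he : ¬ Even (n + k)) :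
    chebCoeff a b n k = 2 * coeffB a b := by
  simp [chebCoeff, he, h.not_gt, h.ne]

/-- The constant term is left unspecified because the index k = 0 has weight zero in the variance.
-/
theorem exists_eval_Phat_eq (a b : ℝ) (n : ℕ) : ∃ c₀ : ℝ, ∀ x,
    (Phat a b n).eval x
      = c₀ + ∑ k ∈ Finset.Icc 1 n, chebCoeff a b n k * (That a b k).eval x := by
  induction n using Nat.twoStepInduction with
  | zero =>
    refine ⟨coeffC a b - coeffA a b, fun x => ?_⟩
    simp [Phat, eval_Uhat]
    ring
  | one =>
    refine ⟨coeffB a b, fun x => ?_⟩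
    simp [Phat, eval_Uhat, eval_That, chebCoeff_self]
    ring
  | more n ih _ =>
    obtain ⟨c₀, hc⟩ := ih
    have e1 : chebCoeff a b (n + 2) (n + 1) = 2 * coeffB a b :=
      chebCoeff_of_not_even a b (by omega) (by
        rw [show n + 2 + (n + 1) = 2 * (n + 1) + 1 by ring]; simp)
    have e0 : chebCoeff a b (n + 2) n - chebCoeff a b n n = 2 * coeffA a b := by
      rw [chebCoeff_of_even a b (by omega) (by
        rw [show n + 2 + n = 2 * (n + 1) by ring]; simp), chebCoeff_self]
      ring
    -- When n = 0, the term 2A'T_0 is itself constant.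
    refine ⟨if n = 0 then c₀ + 2 * coeffA a b else c₀, fun x => ?_⟩
    rw [eval_Phat_add_two, hc x, Finset.sum_Icc_succ_top (by omega : 1 ≤ n + 1 + 1),
      Finset.sum_Icc_succ_top (by omega : 1 ≤ n + 1), chebCoeff_self, e1]
    rcases n with - | n
    · simp [eval_That]
      ring
    · have : ∑ k ∈ Finset.Icc 1 n, chebCoeff a b (n + 1 + 2) k * (That a b k).eval x
          = ∑ k ∈ Finset.Icc 1 n, chebCoeff a b (n + 1) k * (That a b k).eval x :=
        Finset.sum_congr rfl fun k hk => by
          rw [sub_eq_zero.1 (chebCoeff_add_two a b (n := n + 1)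
            (by have := (Finset.mem_Icc.1 hk).2; omega))]
      rw [Finset.sum_Icc_succ_top (by omega : 1 ≤ n + 1),
        Finset.sum_Icc_succ_top (by omega : 1 ≤ n + 1), this, if_neg (Nat.succ_ne_zero n)]
      push_cast at e0 ⊢
      rw [show (n : ℤ) + 1 + 2 = n + 1 + 1 + 1 by ring]
      linear_combination -(That a b (n + 1)).eval x * e0

/-- The variance of a combination of the polynomials `Phat`, as a sum of squares of Chebyshev
coefficients. -/
theorem hasVariance_sum_Phat {a b : ℝ} (hab : a < b) (c : ℕ → ℝ) (K : ℕ) :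
    HasVariance a b (fun x => ∑ n ∈ Finset.range (K + 1), c n * (Phat a b n).eval x)
      (1 / 4 * ∑ k ∈ Finset.Icc 1 K,
        k * (∑ n ∈ Finset.Icc 1 K, c n * chebCoeff a b n k) ^ 2) := by
  choose c₀ hc₀ using exists_eval_Phat_eq a b
  have split : ∀ g : ℕ → ℝ, ∑ k ∈ Finset.range (K + 1), g k = g 0 + ∑ k ∈ Finset.Icc 1 K, g k := by
    intro g
    rw [Finset.range_eq_Ico, Finset.sum_eq_sum_Ico_succ_bot (by omega)]
    rfl
  set e : ℕ → ℝ := fun k => if k = 0 then ∑ n ∈ Finset.range (K + 1), c n * c₀ n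
    else ∑ n ∈ Finset.Icc 1 K, c n * chebCoeff a b n k with he
  have hepos : ∀ k ∈ Finset.Icc 1 K, e k = ∑ n ∈ Finset.Icc 1 K, c n * chebCoeff a b n k := by
    intro k hk
    have : k ≠ 0 := by have := (Finset.mem_Icc.1 hk).1; omega
    simp only [he, if_neg this]
  have hV := hasVariance_sum_That hab e K
  convert hV using 1
  · ext x
    have h1 : ∀ n ∈ Finset.range (K + 1), c n * (Phat a b n).eval x = c n * c₀ n
        + ∑ k ∈ Finset.Icc 1 K, c n * chebCoeff a b n k * (That a b k).eval x := by
      intro n hn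
      have hn' := Finset.mem_range.1 hn
      rw [hc₀, mul_add, Finset.mul_sum]
      congr 1
      rw [Finset.sum_subset (Finset.Icc_subset_Icc_right (by omega : n ≤ K))]
      · exact Finset.sum_congr rfl fun k _ => by ring
      · intro k hk hk'
        rw [Finset.mem_Icc] at hk hk'
        rw [chebCoeff_of_lt a b (by omega)]
        ring
    rw [Finset.sum_congr rfl h1, Finset.sum_add_distrib, split (fun k => e k * _),
      split (fun n => ∑ k ∈ Finset.Icc 1 K, c n * chebCoeff a b n k * (That a b k).eval x)]
    have hz : ∑ k ∈ Finset.Icc 1 K, c 0 * chebCoeff a b 0 k * (That a b k).eval x = 0 :=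
      Finset.sum_eq_zero fun k hk => by
        rw [chebCoeff_of_lt a b (by have := (Finset.mem_Icc.1 hk).1; omega)]; ring
    rw [hz, zero_add, Finset.sum_comm]
    congr 1
    · simp [he, eval_That]
    · refine Finset.sum_congr rfl fun k hk => ?_
      rw [hepos k hk, Finset.sum_mul]
  · rw [split]
    simp only [Nat.cast_zero, zero_mul, zero_add]
    congr 1
    exact Finset.sum_congr rfl fun k hk => by rw [hepos k hk]

/-! ### The matrix of the quadratic form -/

theorem sum_Icc_mul_ite_even (X Y : ℝ) (n : ℕ) :
    ∑ k ∈ Finset.Icc 1 n, (k : ℝ) * (if Even k then X else Y)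
      = if Even n then X * (n * (n + 2) / 4) + Y * (n ^ 2 / 4)
        else X * ((n ^ 2 - 1) / 4) + Y * ((n + 1) ^ 2 / 4) := by
  induction n with
  | zero => simp
  | succ n ih =>
    rw [Finset.sum_Icc_succ_top (by omega), ih]
    by_cases h : Even n
    · have h' : ¬ Even (n + 1) := by simp [Nat.even_add_one, h]
      simp only [if_pos h, if_neg h']
      push_cast
      ring
    · have h' : Even (n + 1) := by simp [Nat.even_add_one, h]
      simp only [if_neg h, if_pos h']
      push_cast
      ring

theorem sqrt_relations {a b : ℝ} (ha : 0 < a) (hab : a < b) (hb : b < 1) :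
    √a ^ 2 = a ∧ √b ^ 2 = b ∧ √(1 - a) ^ 2 = 1 - a ∧ √(1 - b) ^ 2 = 1 - b ∧
    √(a * (1 - a)) = √a * √(1 - a) ∧ √(b * (1 - b)) = √b * √(1 - b) ∧
    √((1 - a) * (1 - b)) = √(1 - a) * √(1 - b) ∧ √(a * b) = √a * √b :=
  ⟨Real.sq_sqrt ha.le, Real.sq_sqrt (by linarith), Real.sq_sqrt (by linarith),
    Real.sq_sqrt (by linarith), Real.sqrt_mul ha.le _, Real.sqrt_mul (by linarith) _,
    Real.sqrt_mul (by linarith) _, Real.sqrt_mul ha.le _⟩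

theorem coeffC_pos {a b : ℝ} (ha : 0 < a) (hab : a < b) (hb : b < 1) : 0 < coeffC a b := by
  have h1 : 0 < √a := Real.sqrt_pos.2 ha
  have h2 : 0 < √b := Real.sqrt_pos.2 (by linarith)
  have h3 : 0 < √(1 - a) := Real.sqrt_pos.2 (by linarith)
  have h4 : 0 < √(1 - b) := Real.sqrt_pos.2 (by linarith)
  unfold coeffC
  positivity

/-- The products of the coefficients occurring in the quadratic form. -/
theorem coeff_products {a b : ℝ} (ha : 0 < a) (hab : a < b) (hb : b < 1) :
    (coeffA a b + coeffC a b) ^ 2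
      = 4 * (b * (1 - b) + a * (1 - a) + 2 * (√((1 - a) * (1 - b)) * √(a * b))) ∧
    coeffB a b ^ 2
      = 4 * (b * (1 - b) + a * (1 - a) - 2 * (√((1 - a) * (1 - b)) * √(a * b))) ∧
    (coeffA a b + coeffC a b) * coeffB a b = 4 * (b * (1 - b) - a * (1 - a)) ∧
    coeffC a b ^ 2
      = (a + b + 2 * √(a * b)) * (2 - a - b + 2 * √((1 - a) * (1 - b))) ∧
    coeffA a b * coeffC a b = -(b - a) ^ 2 ∧
    coeffB a b * coeffC a b = 2 * (b * (1 - b) - a * (1 - a) + (b - a) * √((1 - a) * (1 - b))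
      - (b - a) * √(a * b)) := by
  obtain ⟨hu, hv, hw, hz, h1, h2, h3, h4⟩ := sqrt_relations ha hab hb
  simp only [coeffA, coeffB, coeffC, h1, h2, h3, h4]
  generalize √a = u at *
  generalize √b = v at *
  generalize √(1 - a) = w at *
  generalize √(1 - b) = z at *
  refine ⟨?_, ?_, ?_, ?_, ?_, ?_⟩ <;> grind

theorem R_symm (a b : ℝ) (m n : ℕ) : R a b m n = R a b n m := by
  rcases lt_trichotomy m n with h | rfl | h
  · by_cases hm : Even m <;> by_cases hn : Even n <;>
      simp [R, hm, hn, h, h.not_gt, h.ne', ← Nat.not_even_iff_odd]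
  · rfl
  · by_cases hm : Even m <;> by_cases hn : Even n <;>
      simp [R, hm, hn, h, h.not_gt, h.ne', ← Nat.not_even_iff_odd]

/-- If `f` depends on the parity of the index except at `n`, then its first moment over `1, …, n`
is explicit. -/
theorem sum_Icc_mul_of_parity {f : ℕ → ℝ} {X Y : ℝ} {n : ℕ} (hn : 1 ≤ n)
    (hX : ∀ k < n, Even k → f k = X) (hY : ∀ k < n, ¬ Even k → f k = Y) :
    ∑ k ∈ Finset.Icc 1 n, (k : ℝ) * f k
      = if Even n then X * (n * (n + 2) / 4) + Y * (n ^ 2 / 4) + n * (f n - X)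
        else X * ((n ^ 2 - 1) / 4) + Y * ((n + 1) ^ 2 / 4) + n * (f n - Y) := by
  obtain ⟨n, rfl⟩ : ∃ m, n = m + 1 := ⟨n - 1, by omega⟩
  have h1 := sum_Icc_mul_ite_even X Y (n + 1)
  rw [Finset.sum_Icc_succ_top (by omega)] at h1 ⊢
  have h2 : ∑ k ∈ Finset.Icc 1 n, (k : ℝ) * f k
      = ∑ k ∈ Finset.Icc 1 n, (k : ℝ) * (if Even k then X else Y) := by
    refine Finset.sum_congr rfl fun k hk => ?_
    have hk' : k < n + 1 := by have := (Finset.mem_Icc.1 hk).2; omega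
    split_ifs with h
    · rw [hX k hk' h]
    · rw [hY k hk' h]
  rw [h2]
  split_ifs at h1 ⊢ <;> linear_combination h1

/-- For k < n ≤ m the product of coefficients depends only on the parity of k, so the sum is a first
moment with a correction at k = n. If m and n have different parity, every k < n gives the same
product 4(A'+C')B'. The diagonal excess n(a-b)² is -nA'C', since the last term has C'² in place of
C'(A'+C'). -/
theorem R_eq_sum_of_le {a b : ℝ} (ha : 0 < a) (hab : a < b) (hb : b < 1) {m n : ℕ} (hn : 1 ≤ n)
    (hnm : n ≤ m) :
    R a b m n = 1 / 4 * ∑ k ∈ Finset.Icc 1 n, (k : ℝ) * (chebCoeff a b m k * chebCoeff a b n k) := by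
  obtain ⟨p1, p2, p3, p4, p5, p6⟩ := coeff_products ha hab hb
  have hk : ∀ i : ℕ, n ≤ i → ∀ k < n, chebCoeff a b i k
      = if Even i ↔ Even k then 2 * (coeffA a b + coeffC a b) else 2 * coeffB a b := by
    intro i hi k hk
    split_ifs with h
    · exact chebCoeff_of_even a b (by omega) (Nat.even_add.2 h)
    · exact chebCoeff_of_not_even a b (by omega) (fun h' => h (Nat.even_add.1 h'))
  have hmn : chebCoeff a b m n = if m = n then 2 * coeffC a b else
      if Even m ↔ Even n then 2 * (coeffA a b + coeffC a b) else 2 * coeffB a b := by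
    split_ifs with h h'
    · rw [h, chebCoeff_self]
    · exact chebCoeff_of_even a b (by omega) (Nat.even_add.2 h')
    · exact chebCoeff_of_not_even a b (by omega) (fun h'' => h' (Nat.even_add.1 h''))
  by_cases hm : Even m <;> by_cases hn' : Even n
  · rw [sum_Icc_mul_of_parity hn (X := (2 * (coeffA a b + coeffC a b)) ^ 2)
      (Y := (2 * coeffB a b) ^ 2)
      (fun k hkn he => by rw [hk m hnm k hkn, hk n le_rfl k hkn]; simp [hm, hn', he]; ring)
      (fun k hkn he => by rw [hk m hnm k hkn, hk n le_rfl k hkn]; simp [hm, hn', he]; ring)]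
    rw [if_pos hn', chebCoeff_self, hmn]
    rcases eq_or_lt_of_le hnm with rfl | hlt
    · simp [R, Reven, ← Nat.not_even_iff_odd, hm]
      linear_combination (-(n * (n + 2) / 4 - n : ℝ)) * p1 - (n ^ 2 / 4 : ℝ) * p2 - (n : ℝ) * p4
    · simp [R, Reven, ← Nat.not_even_iff_odd, hm, hn', hlt, hlt.ne']
      linear_combination (-(n * (n + 2) / 4 - n : ℝ)) * p1 - (n ^ 2 / 4 : ℝ) * p2 - (n : ℝ) * p4 - (n : ℝ) * p5
  · rw [sum_Icc_mul_of_parity hn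
      (X := 4 * ((coeffA a b + coeffC a b) * coeffB a b))
      (Y := 4 * ((coeffA a b + coeffC a b) * coeffB a b))
      (fun k hkn he => by rw [hk m hnm k hkn, hk n le_rfl k hkn]; simp [hm, hn', he]; ring)
      (fun k hkn he => by rw [hk m hnm k hkn, hk n le_rfl k hkn]; simp [hm, hn', he]; ring)]
    have hlt : n < m := lt_of_le_of_ne hnm (by rintro rfl; exact hn' hm)
    rw [if_neg hn', chebCoeff_self, hmn]
    simp [R, Rmixed, ← Nat.not_even_iff_odd, hm, hn', hlt, hlt.ne']
    linear_combination (-((n ^ 2 - 1) / 4 + (n + 1) ^ 2 / 4 - n : ℝ)) * p3 - (n : ℝ) * p6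
  · rw [sum_Icc_mul_of_parity hn
      (X := 4 * ((coeffA a b + coeffC a b) * coeffB a b))
      (Y := 4 * ((coeffA a b + coeffC a b) * coeffB a b))
      (fun k hkn he => by rw [hk m hnm k hkn, hk n le_rfl k hkn]; simp [hm, hn', he]; ring)
      (fun k hkn he => by rw [hk m hnm k hkn, hk n le_rfl k hkn]; simp [hm, hn', he]; ring)]
    have hlt : n < m := lt_of_le_of_ne hnm (by rintro rfl; exact hm hn')
    rw [if_pos hn', chebCoeff_self, hmn]
    simp [R, Rmixed, hm, hn', hlt, hlt.ne']
    linear_combination (-(n * (n + 2) / 4 + n ^ 2 / 4 - n : ℝ)) * p3 - (n : ℝ) * p6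
  · rw [sum_Icc_mul_of_parity hn (X := (2 * coeffB a b) ^ 2)
      (Y := (2 * (coeffA a b + coeffC a b)) ^ 2)
      (fun k hkn he => by rw [hk m hnm k hkn, hk n le_rfl k hkn]; simp [hm, hn', he]; ring)
      (fun k hkn he => by rw [hk m hnm k hkn, hk n le_rfl k hkn]; simp [hm, hn', he]; ring)]
    rw [if_neg hn', chebCoeff_self, hmn]
    rcases eq_or_lt_of_le hnm with rfl | hlt
    · simp [R, Rodd, hm]
      linear_combination (-((n + 1) ^ 2 / 4 - n : ℝ)) * p1 - ((n ^ 2 - 1) / 4 : ℝ) * p2 - (n : ℝ) * p4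
    · simp [R, Rodd, hm, hn', hlt, hlt.ne']
      linear_combination (-((n + 1) ^ 2 / 4 - n : ℝ)) * p1 - ((n ^ 2 - 1) / 4 : ℝ) * p2 - (n : ℝ) * p4 - (n : ℝ) * p5

theorem R_eq_sum {a b : ℝ} (ha : 0 < a) (hab : a < b) (hb : b < 1) {K m n : ℕ}
    (hm : m ∈ Finset.Icc 1 K) (hn : n ∈ Finset.Icc 1 K) :
    R a b m n = 1 / 4 * ∑ k ∈ Finset.Icc 1 K, (k : ℝ) * (chebCoeff a b m k * chebCoeff a b n k) := by
  rw [Finset.mem_Icc] at hm hn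
  have key : ∀ i j : ℕ, 1 ≤ j → j ≤ i → j ≤ K →
      R a b i j = 1 / 4 * ∑ k ∈ Finset.Icc 1 K,
        (k : ℝ) * (chebCoeff a b i k * chebCoeff a b j k) := by
    intro i j hj hji hjK
    rw [R_eq_sum_of_le ha hab hb hj hji]
    congr 1
    refine Finset.sum_subset (Finset.Icc_subset_Icc_right hjK) fun k hk hk' => ?_
    rw [Finset.mem_Icc] at hk hk'
    rw [chebCoeff_of_lt a b (n := j) (by omega)]
    ring
  rcases le_total n m with h | h
  · exact key m n hn.1 h hn.2
  · rw [R_symm, key n m hm.1 h hm.2]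
    simp only [mul_comm (chebCoeff a b n _)]

/-- The variance as the quadratic form with matrix `R`. -/
theorem hasVariance_sum_Phat_R {a b : ℝ} (ha : 0 < a) (hab : a < b) (hb : b < 1) (K : ℕ)
    (c : ℕ → ℝ) :
    HasVariance a b (fun x => ∑ n ∈ Finset.range (K + 1), c n * (Phat a b n).eval x)
      (∑ m ∈ Finset.Icc 1 K, ∑ n ∈ Finset.Icc 1 K, c m * c n * R a b m n) := by
  convert hasVariance_sum_Phat hab c K using 1
  have h : ∀ m ∈ Finset.Icc 1 K, ∀ n ∈ Finset.Icc 1 K, c m * c n * R a b m n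
      = ∑ k ∈ Finset.Icc 1 K,
        1 / 4 * ((k : ℝ) * ((c m * chebCoeff a b m k) * (c n * chebCoeff a b n k))) := by
    intro m hm n hn
    rw [R_eq_sum ha hab hb hm hn, Finset.mul_sum, Finset.mul_sum]
    exact Finset.sum_congr rfl fun k _ => by ring
  rw [Finset.sum_congr rfl fun m hm => Finset.sum_congr rfl fun n hn => h m hm n hn,
    Finset.mul_sum, Finset.sum_congr rfl fun m _ => Finset.sum_comm, Finset.sum_comm]
  refine Finset.sum_congr rfl fun k _ => ?_
  rw [pow_two, Finset.sum_mul_sum, Finset.mul_sum, Finset.mul_sum]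
  refine Finset.sum_congr rfl fun m _ => ?_
  rw [Finset.mul_sum, Finset.mul_sum]

/-! ### The change of variables for five coefficients -/

/-- The coefficient matrix is upper triangular Toeplitz with diagonals 2C', 2B', 2(A'+C'), 2B',
2(A'+C'). These relations say that its product with M is twice the identity. -/
theorem transform5_inverse_relations {a b : ℝ} (ha : 0 < a) (hab : a < b) (hb : b < 1) :
    coeffC a b * α a b = 1 ∧
    coeffC a b * β a b + coeffB a b * α a b = 0 ∧
    coeffC a b * γ a b + coeffB a b * β a b + (coeffA a b + coeffC a b) * α a b = 0 ∧
    coeffC a b * ξ a b + coeffB a b * γ a b + (coeffA a b + coeffC a b) * β a b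
      + coeffB a b * α a b = 0 ∧
    coeffC a b * ζ a b + coeffB a b * ξ a b + (coeffA a b + coeffC a b) * γ a b
      + coeffB a b * β a b + (coeffA a b + coeffC a b) * α a b = 0 := by
  obtain ⟨hu, hv, hw, hz, h1, h2, -, -⟩ := sqrt_relations ha hab hb
  have hp : 0 < √a + √b := by
    have := Real.sqrt_pos.2 ha
    positivity
  have hq : 0 < √(1 - a) + √(1 - b) := by
    have := Real.sqrt_pos.2 (sub_pos.2 hb)
    positivity
  have hC : coeffC a b = (√a + √b) * (√(1 - a) + √(1 - b)) := by unfold coeffC; ring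
  have hB : coeffB a b = -2 * (√(a * (1 - a)) - √(b * (1 - b))) := by unfold coeffB; ring
  have hAC : coeffA a b + coeffC a b = 2 * (√(a * (1 - a)) + √(b * (1 - b))) := by
    rw [coeffA, coeffC, h1, h2]; ring
  have hDS : (a - b) * (1 - a - b) = (√(a * (1 - a)) - √(b * (1 - b)))
      * (√(a * (1 - a)) + √(b * (1 - b))) := by
    rw [h1, h2]; grind
  -- Eliminating S through this formula, with δ = √a - √b, turns the five relations into identities
  -- of rational functions in D, p, q, δ.
  have hS : √(a * (1 - a)) + √(b * (1 - b)) = (√a + √b)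
      * ((√(1 - a) + √(1 - b)) ^ 2 - (√a - √b) ^ 2) / (2 * (√(1 - a) + √(1 - b))) := by
    rw [eq_div_iff (by positivity), h1, h2]; grind
  have hpne := hp.ne'
  have hqne := hq.ne'
  have e4 : 4 * (a - b) * (1 - a - b) = 4 * ((√(a * (1 - a)) - √(b * (1 - b)))
      * (√(a * (1 - a)) + √(b * (1 - b)))) := by rw [← hDS]; ring
  rw [hAC, hC, hB, α, β, γ, ξ, ζ, e4, hS]
  generalize √(a * (1 - a)) - √(b * (1 - b)) = D
  generalize √a + √b = p at *
  generalize √(1 - a) + √(1 - b) = q at *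
  generalize √a - √b = δ
  refine ⟨?_, ?_, ?_, ?_, ?_⟩ <;> field_simp <;> ring

theorem isUnit_det_transform5 {a b : ℝ} (ha : 0 < a) (hab : a < b) (hb : b < 1) :
    IsUnit (transform5 a b).det := by
  have hα : α a b ≠ 0 := right_ne_zero_of_mul
    ((transform5_inverse_relations ha hab hb).1.trans_ne one_ne_zero)
  have hT : (transform5 a b).BlockTriangular id := by
    intro i j hij
    fin_cases i <;> fin_cases j <;> first | rfl | (exact absurd hij (by decide))
  rw [Matrix.det_of_isUpperTriangular hT, isUnit_iff_ne_zero, Finset.prod_ne_zero_iff]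
  intro i _
  fin_cases i <;> exact hα

theorem hasVariance_transform5 {a b : ℝ} (ha : 0 < a) (hab : a < b) (hb : b < 1) (c : ℕ → ℝ)
    (d : Fin 5 → ℝ) (h : (fun i : Fin 5 => c (i.val + 1)) = transform5 a b *ᵥ d) :
    HasVariance a b (fun x => ∑ n ∈ Finset.range 6, c n * (Phat a b n).eval x)
      (∑ i : Fin 5, ((i.val + 1 : ℕ) : ℝ) * d i ^ 2) := by
  convert hasVariance_sum_Phat hab c 5 using 1
  obtain ⟨h1, h2, h3, h4, h5⟩ := transform5_inverse_relations ha hab hb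
  have c1 := congrFun h 0
  have c2 := congrFun h 1
  have c3 := congrFun h 2
  have c4 := congrFun h 3
  have c5 := congrFun h 4
  simp [transform5, Matrix.mulVec, dotProduct, Fin.sum_univ_five] at c1 c2 c3 c4 c5
  have hsum : ∀ g : ℕ → ℝ, ∑ k ∈ Finset.Icc 1 5, g k = g 1 + g 2 + g 3 + g 4 + g 5 := by
    intro g
    simp [Finset.sum_Icc_succ_top]
  have e : ∀ k : ℕ, ∑ n ∈ Finset.Icc 1 5, c n * chebCoeff a b n k
      = c 1 * chebCoeff a b 1 k + c 2 * chebCoeff a b 2 k + c 3 * chebCoeff a b 3 k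
        + c 4 * chebCoeff a b 4 k + c 5 * chebCoeff a b 5 k := by
    intro k
    exact hsum _
  -- Each Chebyshev coefficient is twice an entry of d, and the square of this 2 absorbs the factor
  -- 1/4. The indices of d start at 0.
  have e1 : ∑ n ∈ Finset.Icc 1 5, c n * chebCoeff a b n 1 = 2 * d 0 := by
    rw [e]
    simp [chebCoeff, show Even 4 by decide, show Even 6 by decide, show ¬ Even 3 by decide,
      show ¬ Even 5 by decide]
    rw [c1, c2, c3, c4, c5]
    linear_combination 2 * d 0 * h1 + 2 * d 1 * h2 + 2 * d 2 * h3 + 2 * d 3 * h4 + 2 * d 4 * h5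
  have e2 : ∑ n ∈ Finset.Icc 1 5, c n * chebCoeff a b n 2 = 2 * d 1 := by
    rw [e]
    simp [chebCoeff, show Even 6 by decide, show ¬ Even 7 by decide, show ¬ Even 5 by decide]
    rw [c2, c3, c4, c5]
    linear_combination 2 * d 1 * h1 + 2 * d 2 * h2 + 2 * d 3 * h3 + 2 * d 4 * h4
  have e3 : ∑ n ∈ Finset.Icc 1 5, c n * chebCoeff a b n 3 = 2 * d 2 := by
    rw [e]
    simp [chebCoeff, show Even 8 by decide, show ¬ Even 7 by decide]
    rw [c3, c4, c5]
    linear_combination 2 * d 2 * h1 + 2 * d 3 * h2 + 2 * d 4 * h3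
  have e4 : ∑ n ∈ Finset.Icc 1 5, c n * chebCoeff a b n 4 = 2 * d 3 := by
    rw [e]
    simp [chebCoeff, show ¬ Even 9 by decide]
    rw [c4, c5]
    linear_combination 2 * d 3 * h1 + 2 * d 4 * h2
  have e5 : ∑ n ∈ Finset.Icc 1 5, c n * chebCoeff a b n 5 = 2 * d 4 := by
    rw [e]
    simp [chebCoeff]
    rw [c5]
    linear_combination 2 * d 4 * h1
  refine Eq.trans ?_ (congrArg _ (hsum _).symm)
  rw [e1, e2, e3, e4, e5, Fin.sum_univ_five]
  norm_num
  ring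

/-! ### Degree and orthogonality -/

theorem degree_Uhat_natCast {a b : ℝ} (hab : a < b) (n : ℕ) :
    (Uhat a b n).degree = (n : WithBot ℕ) := by
  have h : (2 / (b - a)) ≠ 0 := by
    have := sub_pos.2 hab
    positivity
  have hlin : (Polynomial.C (2 / (b - a)) * X - Polynomial.C ((b + a) / (b - a))).natDegree = 1 := by
    rw [sub_eq_add_neg, ← Polynomial.C_neg]
    exact natDegree_linear h
  have hn : (Uhat a b n).natDegree = n := by
    rw [Uhat, natDegree_comp, hlin, Chebyshev.natDegree_U_natCast, mul_one]
  rcases n with - | n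
  · simp [Uhat]
  · rw [degree_eq_natDegree (ne_zero_of_natDegree_gt (n := n) (by omega)), hn]

theorem coeffA_neg {a b : ℝ} (ha : 0 < a) (hab : a < b) (hb : b < 1) : coeffA a b < 0 :=
  mul_neg_of_pos_of_neg (sub_pos.2 (Real.sqrt_lt_sqrt ha.le hab))
    (sub_neg.2 (Real.sqrt_lt_sqrt (by linarith) (by linarith)))

theorem degree_Phat {a b : ℝ} (ha : 0 < a) (hab : a < b) (hb : b < 1) (n : ℕ) :
    (Phat a b n).degree = (n : WithBot ℕ) := by
  have hC := coeffC_pos ha hab hb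
  have hA := coeffA_neg ha hab hb
  have lead : (coeffC a b • Uhat a b (n : ℤ)).degree = (n : WithBot ℕ) := by
    rw [degree_smul_of_smul_regular _ (IsSMulRegular.of_ne_zero hC.ne'), degree_Uhat_natCast hab]
  rcases n with - | - | n
  -- The value U_{-2} = -1 contributes -A'; the constant is nonzero because A' < 0 < C'.
  · have : Phat a b 0 = Polynomial.C (coeffC a b - coeffA a b) := by
      simp [Phat, Uhat, smul_eq_C_mul]
      ring
    rw [this, degree_C (by linarith)]
    rfl
  · rw [Phat, degree_add_eq_right_of_degree_lt]
    · exact lead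
    · rw [lead]
      refine (degree_le_of_natDegree_le (n := 0) ?_).trans_lt (by norm_num)
      simp [Uhat, smul_eq_C_mul]
  · rw [Phat, degree_add_eq_right_of_degree_lt]
    · exact lead
    · rw [lead]
      have e2 : ((n + 2 : ℕ) : ℤ) - 2 = (n : ℕ) := by push_cast; ring
      have e1 : ((n + 2 : ℕ) : ℤ) - 1 = (n + 1 : ℕ) := by push_cast; ring
      rw [e2, e1]
      refine (degree_add_le _ _).trans_lt (max_lt ?_ ?_)
      · refine (degree_smul_le _ _).trans_lt ?_
        rw [degree_Uhat_natCast hab]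
        exact_mod_cast (by omega : n < n + 2)
      · refine (degree_smul_le _ _).trans_lt ?_
        rw [degree_Uhat_natCast hab]
        exact_mod_cast (by omega : n + 1 < n + 2)

theorem add_mul_ne_zero {p r : ℝ} (h : |r| < p) {z : ℂ} (hz : ‖z‖ ≤ 1) :
    (p : ℂ) + r * z ≠ 0 := by
  intro h0
  have h1 : (p : ℂ) = -(r * z) := eq_neg_of_add_eq_zero_left h0
  have h2 : ‖(p : ℂ)‖ ≤ |r| := by
    rw [h1, norm_neg, norm_mul, Complex.norm_real, Real.norm_eq_abs]
    exact mul_le_of_le_one_right (abs_nonneg r) hz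
  rw [Complex.norm_real, Real.norm_eq_abs] at h2
  linarith [le_abs_self p]

/-- The polynomial `C' + B' z + A' z²` has no zeros in the closed unit disc. -/
theorem coeff_quadratic_ne_zero {a b : ℝ} (ha : 0 < a) (hab : a < b) (hb : b < 1) {z : ℂ}
    (hz : ‖z‖ ≤ 1) : (coeffC a b : ℂ) + coeffB a b * z + coeffA a b * z ^ 2 ≠ 0 := by
  obtain ⟨-, -, -, -, h1, h2, -, -⟩ := sqrt_relations ha hab hb
  have hu := Real.sqrt_pos.2 ha
  have hv := Real.sqrt_pos.2 (ha.trans hab)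
  have hw := Real.sqrt_pos.2 (sub_pos.2 (hab.trans hb))
  have hz' := Real.sqrt_pos.2 (sub_pos.2 hb)
  -- The quadratic splits into two real linear factors, one built from √a, √b and the other from
  -- √(1-a), √(1-b); each has its constant term dominating.
  have f1 := add_mul_ne_zero (p := √b + √a) (r := √b - √a)
    (by rw [abs_lt]; constructor <;> linarith) hz
  have f2 := add_mul_ne_zero (p := √(1 - b) + √(1 - a)) (r := √(1 - b) - √(1 - a))
    (by rw [abs_lt]; constructor <;> linarith) hz
  convert mul_ne_zero f1 f2 using 1
  rw [coeffA, coeffB, coeffC, h1, h2]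
  push_cast
  ring

/-- The mean value property for `z ^ N (C' z² + B' z + A') / (C' + B' z + A' z²)`. -/
theorem integral_re_reflected_quotient {a b : ℝ} (ha : 0 < a) (hab : a < b) (hb : b < 1) {N : ℕ}
    (hN : 1 ≤ N) (F : ℂ → ℂ) (hF : F = fun z => z ^ N
      * ((coeffC a b : ℂ) * z ^ 2 + (coeffB a b : ℂ) * z + (coeffA a b : ℂ))
      / ((coeffC a b : ℂ) + (coeffB a b : ℂ) * z + (coeffA a b : ℂ) * z ^ 2)) :
    Continuous (fun θ : ℝ => (F (circleMap 0 1 θ)).re) ∧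
    ∫ θ in 0..2 * Real.pi, (F (circleMap 0 1 θ)).re = 0 := by
  have hne : ∀ z ∈ Metric.closedBall (0 : ℂ) 1,
      (coeffC a b : ℂ) + coeffB a b * z + coeffA a b * z ^ 2 ≠ 0 := fun z hz =>
    coeff_quadratic_ne_zero ha hab hb (by simpa using hz)
  have hmem : ∀ θ : ℝ, circleMap 0 1 θ ∈ Metric.closedBall (0 : ℂ) 1 := fun θ =>
    circleMap_mem_closedBall 0 zero_le_one θ
  have hd : DiffContOnCl ℂ F (Metric.ball 0 |1|) := by
    rw [abs_one]
    refine DifferentiableOn.diffContOnCl ?_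
    rw [closure_ball _ one_ne_zero, hF]
    exact DifferentiableOn.div (by fun_prop) (by fun_prop) hne
  have hc : Continuous (fun θ : ℝ => F (circleMap 0 1 θ)) := by
    simp only [hF]
    exact Continuous.div (by fun_prop) (by fun_prop) fun θ => hne _ (hmem θ)
  refine ⟨Complex.continuous_re.comp hc, ?_⟩
  have hav := hd.circleAverage
  rw [Real.circleAverage] at hav
  -- The factor z^N with N ≥ 1 makes the central value vanish.
  have h0 : F 0 = 0 := by simp [hF, Nat.one_le_iff_ne_zero.1 hN]
  rw [h0, smul_eq_zero_iff_right (by positivity)] at hav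
  have hre := Complex.reCLM.intervalIntegral_comp_comm
    (hc.intervalIntegrable (μ := volume) 0 (2 * Real.pi))
  rw [hav] at hre
  simpa using hre

/-- The product of two of the polynomials `Phat` against the weight, in the angular variable. -/
theorem eval_Phat_mul_eval_Phat_angular {a b : ℝ} (ha : 0 < a) (hab : a < b) (hb : b < 1)
    (m n : ℕ) (F : ℂ → ℂ) (hF : F = fun z => z ^ (m + n)
      * ((coeffC a b : ℂ) * z ^ 2 + (coeffB a b : ℂ) * z + (coeffA a b : ℂ))
      / ((coeffC a b : ℂ) + (coeffB a b : ℂ) * z + (coeffA a b : ℂ) * z ^ 2)) (θ x : ℝ)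
    (hx : x = (b - a) / 2 * Real.cos θ + (a + b) / 2) :
    (Phat a b m).eval x * (Phat a b n).eval x / (x * (1 - x)) * Real.sin θ ^ 2
      = 8 * (Real.cos (((m : ℤ) - n : ℤ) * θ) - (F (circleMap 0 1 θ)).re) := by
  set A := coeffA a b with hA
  set B := coeffB a b with hB
  set C := coeffC a b with hC
  obtain ⟨p1, p2, p3, -, p5, -⟩ := coeff_products ha hab hb
  rw [← hA, ← hC] at p1 p5
  rw [← hB] at p2
  rw [← hA, ← hB, ← hC] at p3
  -- `Hr` and `Hi` are the real and imaginary parts of h(exp(iθ)).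
  set Hr : ℝ := C + B * Real.cos θ + A * Real.cos (2 * θ) with hHr
  set Hi : ℝ := B * Real.sin θ + A * Real.sin (2 * θ) with hHi
  have hxI : 0 < x * (1 - x) := by
    have h1 := Real.cos_le_one θ
    have h2 := Real.neg_one_le_cos θ
    have h3 : 0 < b - a := sub_pos.2 hab
    refine mul_pos ?_ ?_ <;> rw [hx] <;> nlinarith
  -- The two linear factors of h have squared moduli 4x and 4(1-x) on the circle.
  have hnorm : Hr ^ 2 + Hi ^ 2 = 16 * (x * (1 - x)) := by
    rw [hHr, hHi, Real.cos_two_mul, Real.sin_two_mul, hx]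
    linear_combination (B + 2 * A * Real.cos θ) ^ 2 * Real.sin_sq_add_cos_sq θ + p1 - 2 * p5 + p2
      + 2 * Real.cos θ * p3 + 2 * (2 * Real.cos θ ^ 2 - 1) * p5
  have heval : ∀ k : ℕ, (Phat a b k).eval x * Real.sin θ
      = Hr * Real.sin ((k + 1) * θ) - Hi * Real.cos ((k + 1) * θ) := by
    intro k
    have hU : ∀ j : ℤ, (Uhat a b j).eval x * Real.sin θ = Real.sin ((j + 1) * θ) := fun j => by
      rw [hx, eval_Uhat_affine hab, Chebyshev.U_real_cos]
    have h0 := hU k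
    have h1 := hU (k - 1)
    have h2 := hU (k - 2)
    push_cast at h0 h1 h2
    rw [show ((k : ℝ) - 2 + 1) * θ = (k + 1) * θ - 2 * θ by ring, Real.sin_sub] at h2
    rw [show ((k : ℝ) - 1 + 1) * θ = (k + 1) * θ - θ by ring, Real.sin_sub] at h1
    simp only [Phat, eval_add, eval_smul, smul_eq_mul]
    rw [hHr, hHi]
    linear_combination A * h2 + B * h1 + C * h0
  have hFre : (F (circleMap 0 1 θ)).re * (16 * (x * (1 - x)))
      = (Hr ^ 2 - Hi ^ 2) * Real.cos ((m + n + 2) * θ) + 2 * Hr * Hi * Real.sin ((m + n + 2) * θ) := by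
    set z : ℂ := circleMap 0 1 θ with hz
    have hzcs : z = Complex.cos θ + Complex.sin θ * Complex.I := by
      simp [hz, circleMap, Complex.exp_mul_I]
    have hI := Complex.I_sq
    have hcs := Complex.sin_sq_add_cos_sq (θ : ℂ)
    have hHrC : (Hr : ℂ) = C + B * Complex.cos θ + A * (2 * Complex.cos θ ^ 2 - 1) := by
      rw [hHr]; push_cast; rw [Complex.cos_two_mul]
    have hHiC : (Hi : ℂ) = B * Complex.sin θ + A * (2 * Complex.sin θ * Complex.cos θ) := by
      rw [hHi]; push_cast; rw [Complex.sin_two_mul]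
    have hden : (C : ℂ) + B * z + A * z ^ 2 = Hr + Hi * Complex.I := by
      rw [hzcs, hHrC, hHiC]
      linear_combination (A : ℂ) * Complex.sin θ ^ 2 * hI - (A : ℂ) * hcs
    have hzw : z * (Complex.cos θ - Complex.sin θ * Complex.I) = 1 := by
      rw [hzcs]
      linear_combination hcs - Complex.sin θ ^ 2 * hI
    have hconj : (Hr : ℂ) - Hi * Complex.I = C + B * (Complex.cos θ - Complex.sin θ * Complex.I)
        + A * (Complex.cos θ - Complex.sin θ * Complex.I) ^ 2 := by
      rw [hHrC, hHiC]
      linear_combination -(A : ℂ) * Complex.sin θ ^ 2 * hI + (A : ℂ) * hcs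
    -- On the unit circle conjugation is z ↦ 1/z, so the reversed polynomial is z² times the
    -- conjugate of h(z).
    have hnum : (C : ℂ) * z ^ 2 + B * z + A = z ^ 2 * (Hr - Hi * Complex.I) := by
      rw [hconj]
      linear_combination (-(B : ℂ) * z - A * (z * (Complex.cos θ - Complex.sin θ * Complex.I) + 1))
        * hzw
    have hnormC : ((Hr : ℂ) + Hi * Complex.I) * (Hr - Hi * Complex.I)
        = ((16 * (x * (1 - x)) : ℝ) : ℂ) := by
      rw [← hnorm]; push_cast
      linear_combination -(Hi : ℂ) ^ 2 * hI
    have hdne : (Hr : ℂ) + Hi * Complex.I ≠ 0 := by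
      intro h
      rw [h, zero_mul] at hnormC
      exact (by positivity : (16 * (x * (1 - x)) : ℝ) ≠ 0) (Complex.ofReal_eq_zero.1 hnormC.symm)
    have hpow : z ^ (m + n + 2)
        = (Real.cos ((m + n + 2) * θ) : ℂ) + (Real.sin ((m + n + 2) * θ) : ℂ) * Complex.I := by
      rw [hzcs, Complex.cos_add_sin_mul_I_pow]
      push_cast
      rfl
    have hFz : F z * ((16 * (x * (1 - x)) : ℝ) : ℂ)
        = z ^ (m + n + 2) * (Hr - Hi * Complex.I) ^ 2 := by
      rw [← hnormC]
      simp only [hF]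
      rw [hden, hnum]
      field_simp
      ring
    rw [← Complex.re_mul_ofReal, hFz, hpow]
    generalize Real.cos ((m + n + 2) * θ) = c
    generalize Real.sin ((m + n + 2) * θ) = s
    simp [pow_two]
    ring
  clear_value Hr Hi
  have hcos : Real.cos (((m : ℤ) - n : ℤ) * θ)
      = Real.cos ((m + 1) * θ) * Real.cos ((n + 1) * θ)
        + Real.sin ((m + 1) * θ) * Real.sin ((n + 1) * θ) := by
    rw [← Real.cos_sub]; push_cast; ring_nf
  rw [show ((m : ℝ) + n + 2) * θ = (m + 1) * θ + (n + 1) * θ by ring, Real.cos_add,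
    Real.sin_add] at hFre
  have hm := heval m
  have hn := heval n
  rw [div_mul_eq_mul_div, div_eq_iff hxI.ne', hcos]
  -- This is Im u · Im v = (Re(u v̄) - Re(uv))/2, with u and v the products of z^(m+1) and z^(n+1)
  -- by the conjugate of h(z).
  calc _ = ((Phat a b m).eval x * Real.sin θ) * ((Phat a b n).eval x * Real.sin θ) := by ring
    _ = _ := by
      rw [hm, hn]
      linear_combination (1 / 2 : ℝ) * hFre + (1 / 2 : ℝ) * (Real.cos ((m + 1) * θ)
        * Real.cos ((n + 1) * θ) + Real.sin ((m + 1) * θ) * Real.sin ((n + 1) * θ)) * hnorm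

theorem orthogonality_Phat {a b : ℝ} (ha : 0 < a) (hab : a < b) (hb : b < 1) (m n : ℕ)
    (hn : 1 ≤ n) :
    IntervalIntegrable (fun x => (Phat a b m).eval x * (Phat a b n).eval x * weight a b x)
      volume a b ∧
    ∫ x in a..b, (Phat a b m).eval x * (Phat a b n).eval x * weight a b x
      = if m = n then 2 * Real.pi * (b - a) ^ 2 else 0 := by
  constructor
  · refine ContinuousOn.intervalIntegrable ?_
    rw [uIcc_of_le hab.le]
    refine ContinuousOn.mul (by fun_prop) (ContinuousOn.div (by fun_prop) (by fun_prop) ?_)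
    intro x hx
    exact (mul_pos (ha.trans_le hx.1) (by linarith [hx.2])).ne'
  set F : ℂ → ℂ := fun z => z ^ (m + n)
      * ((coeffC a b : ℂ) * z ^ 2 + (coeffB a b : ℂ) * z + (coeffA a b : ℂ))
      / ((coeffC a b : ℂ) + (coeffB a b : ℂ) * z + (coeffA a b : ℂ) * z ^ 2) with hF
  obtain ⟨hFc, hF0⟩ := integral_re_reflected_quotient ha hab hb (by omega : 1 ≤ m + n) F hF
  set G : ℝ → ℝ := fun θ => (Phat a b m).eval ((b - a) / 2 * Real.cos θ + (a + b) / 2)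
    * (Phat a b n).eval ((b - a) / 2 * Real.cos θ + (a + b) / 2)
    / (((b - a) / 2 * Real.cos θ + (a + b) / 2) * (1 - ((b - a) / 2 * Real.cos θ + (a + b) / 2)))
    * Real.sin θ ^ 2 with hG
  have hGF : ∀ θ, G θ = 8 * (Real.cos (((m : ℤ) - n : ℤ) * θ) - (F (circleMap 0 1 θ)).re) :=
    fun θ => eval_Phat_mul_eval_Phat_angular ha hab hb m n F hF θ _ rfl
  have hGc : Continuous G := by
    rw [funext hGF]
    fun_prop
  have hcos : ∫ θ in 0..2 * Real.pi, Real.cos (((m : ℤ) - n : ℤ) * θ)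
      = if m = n then 2 * Real.pi else 0 := by
    split_ifs with h
    · simp [h]
    · have hk : (((m : ℤ) - n : ℤ) : ℝ) ≠ 0 := by
        rw [Int.cast_ne_zero, sub_ne_zero]
        exact_mod_cast h
      rw [intervalIntegral.integral_comp_mul_left _ hk, integral_cos, mul_zero, Real.sin_zero,
        ← mul_assoc]
      have : Real.sin ((((m : ℤ) - n : ℤ) : ℝ) * 2 * Real.pi) = 0 := by
        have := Real.sin_int_mul_pi (((m : ℤ) - n) * 2)
        push_cast at this ⊢
        exact this
      rw [this]
      simp
  have hfull : ∫ θ in 0..2 * Real.pi, G θ = if m = n then 16 * Real.pi else 0 := by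
    rw [funext hGF, intervalIntegral.integral_const_mul, intervalIntegral.integral_sub
      (Continuous.intervalIntegrable (by fun_prop) _ _) (hFc.intervalIntegrable _ _), hF0, hcos]
    split_ifs <;> ring
  -- The mean value property concerns the whole circle, the substitution only the upper half; θ ↦ 2π
  -- - θ shows that the halves contribute equally.
  have hsym : ∫ θ in Real.pi..2 * Real.pi, G θ = ∫ θ in 0..Real.pi, G θ := by
    have := intervalIntegral.integral_comp_sub_left (a := 0) (b := Real.pi) G (2 * Real.pi)
    rw [show 2 * Real.pi - Real.pi = Real.pi by ring, sub_zero] at this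
    rw [← this]
    refine intervalIntegral.integral_congr fun θ _ => ?_
    simp only [hG, Real.cos_two_pi_sub, Real.sin_two_pi_sub, neg_sq]
  have hsplit := intervalIntegral.integral_add_adjacent_intervals (μ := volume)
    (hGc.intervalIntegrable 0 Real.pi) (hGc.intervalIntegrable Real.pi (2 * Real.pi))
  rw [hsym, hfull] at hsplit
  have hmain := integral_mul_sqrt_eq_integral_cos hab
    (fun x => (Phat a b m).eval x * (Phat a b n).eval x / (x * (1 - x)))
  have hw : ∫ x in a..b, (Phat a b m).eval x * (Phat a b n).eval x * weight a b x
      = ((b - a) / 2) ^ 2 * ∫ θ in 0..Real.pi, G θ := by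
    rw [← hmain]
    refine intervalIntegral.integral_congr fun x _ => ?_
    simp only [weight]
    ring
  rw [hw]
  split_ifs at hsplit ⊢ <;> linear_combination ((b - a) / 2) ^ 2 / 2 * hsplit

end LinStat

theorem mainTheorem4 (a b : ℝ) (ha : 0 < a) (hab : a < b) (hb : b < 1) :
    -- `P̂_n` has degree `n`, and the orthogonality relation holds
    (∀ n : ℕ, (LinStat.Phat a b n).degree = (n : WithBot ℕ)) ∧
    (∀ m n : ℕ, 1 ≤ n →
      IntervalIntegrable
        (fun x => (LinStat.Phat a b m).eval x * (LinStat.Phat a b n).eval x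
          * LinStat.weight a b x) volume a b ∧
      ∫ x in a..b, (LinStat.Phat a b m).eval x * (LinStat.Phat a b n).eval x
          * LinStat.weight a b x
        = if m = n then 2 * Real.pi * (b - a) ^ 2 else 0) ∧
    -- the variance is the quadratic form with the symmetric matrix `R`
    (∀ m n : ℕ, 1 ≤ m → 1 ≤ n → LinStat.R a b m n = LinStat.R a b n m) ∧
    (∀ (K : ℕ) (c : ℕ → ℝ),
      LinStat.HasVariance a b
        (fun x => ∑ n ∈ Finset.range (K + 1), c n * (LinStat.Phat a b n).eval x)
        (∑ m ∈ Finset.Icc 1 K, ∑ n ∈ Finset.Icc 1 K, c m * c n * LinStat.R a b m n)) ∧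
    -- the case `K = 5`: an invertible change of variables, and the sum of squares
    IsUnit (LinStat.transform5 a b).det ∧
    (∀ (c : ℕ → ℝ) (d : Fin 5 → ℝ),
      (fun i : Fin 5 => c (i.val + 1)) = LinStat.transform5 a b *ᵥ d →
      LinStat.HasVariance a b
        (fun x => ∑ n ∈ Finset.range 6, c n * (LinStat.Phat a b n).eval x)
        (∑ i : Fin 5, ((i.val + 1 : ℕ) : ℝ) * d i ^ 2)) := by
  exact ⟨LinStat.degree_Phat ha hab hb, LinStat.orthogonality_Phat ha hab hb,
    fun m n _ _ => LinStat.R_symm a b m n, LinStat.hasVariance_sum_Phat_R ha hab hb,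
    LinStat.isUnit_det_transform5 ha hab hb, LinStat.hasVariance_transform5 ha hab hb⟩
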